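/- Work on $\mathbb R^5$. Let $\kappa_1,\kappa_2,\kappa_3>0$ satisfy the mass-resonance condition $\frac1{\kappa_3}=\frac1{\kappa_1}+\frac1{\kappa_2}$. For $\mathbf u=(u^1,u^2,u^3)\in \mathrm H^1:=H^1(\mathbb R^5;\mathbb C)^3$ put $$M(\mathbf u)=\tfrac12\|u^1\|_{L^2}^2+\tfrac12\|u^2\|_{L^2}^2+\|u^3\|_{L^2}^2,\qquad K(\mathbf u)=\sum_{i=1}^3\tfrac{\kappa_i}{2}\|\nabla u^i\|_{L^2}^2,\qquad V(\mathbf u)=\Re\int_{\mathbb R^5}\overline{u^1}\,\overline{u^2}\,u^3\,dx,$$ and, for $\xi\in\mathbb R^5$, $\mathbf u^\xi(x)=(e^{ix\cdot\xi/\kappa_1}u^1(x),e^{ix\cdot\xi/\kappa_2}u^2(x),e^{ix\cdot\xi/\kappa_3}u^3(x))$. A ground state is a triple $\mathbf Q=(\phi_1,\phi_2,\phi_3)\in\mathrm H^1$ of non-negative radial functions with $V(\mathbf Q)\neq0$ which is a weak solution of $\phi_1-\kappa_1\Delta\phi_1=\phi_2\phi_3$, $\phi_2-\kappa_2\Delta\phi_2=\phi_1\phi_3$,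 $2\phi_3-\kappa_3\Delta\phi_3=\phi_1\phi_2$, and which minimizes $J(\mathbf u)=M(\mathbf u)^{1/2}K(\mathbf u)^{5/2}V(\mathbf u)^{-2}$ among all $\mathbf u\in\mathrm H^1$ with $V(\mathbf u)\ne0$. Let $\chi\in C^\infty(\mathbb R^5)$ be a radially decreasing function with $\chi(x)=1$ for $|x|\le 1-\varepsilon$ and $\chi(x)=0$ for $|x|>1$, for some $0<\varepsilon<1$. For $s\in\mathbb R^5$ and $R>0$ put $\chi_R(x)=\chi(\frac{x-s}{R})$ and $$\xi_{s,R}(\mathbf u)=-\frac{\kappa_1\kappa_2\kappa_3\int\Im\big(\overline{u^1}\nabla u^1+\overline{u^2}\nabla u^2+\overline{u^3}\nabla u^3\big)\chi_R^2\,dx}{\int\big(\kappa_2\kappa_3|u^1|^2+\kappa_1\kappa_3|u^2|^2+\kappa_1\kappa_2|u^3|^2\big)\chi_R^2\,dx},$$ with $\xi_{s,R}(\mathbf u)=0$ if the denominator is $0$. For every $\delta\in(0,1)$ there is $\delta'=\delta'(\delta)>0$ (independent of the $\kappa_i$, of $\mathbf Q$ and of $\chi$) such that for every ground state $\mathbf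 Q$ the following hold. (1) (Coercivity.) If $\mathbf u\in \mathrm H^1$ satisfies $M(\mathbf u)K(\mathbf u)\le(1-\delta)M(\mathbf Q)K(\mathbf Q)$, then for every $\xi\in\mathbb R^5$ one has $\mathbf u^\xi\in\mathrm H^1$ and $$4K(\mathbf u^\xi)-5V(\mathbf u)\ \ge\ \delta' K(\mathbf u^\xi).$$ (2) (Coercivity on balls.) For every $\delta_0>\delta$ and every $m$ there is $R_0>0$, depending only on $\delta,\delta_0,m,\mathbf Q$ (and on the fixed $\kappa_i$ and $\chi$), such that for all $R\ge R_0$, all $s\in\mathbb R^5$ and all time-dependent $\mathbf u:\mathbb R\to\mathrm H^1$ with $M(\mathbf u(t))\le m$ and $M(\mathbf u(t))K(\mathbf u(t))\le(1-\delta_0)M(\mathbf Q)K(\mathbf Q)$ for all $t\in\mathbb R$ (in particular for solutions of the Schrödinger system with conserved mass $m$), writing $\xi(t)=\xi_{s,R}(\mathbf u(t))$, $\mathbf u_R(t)=\chi_R\mathbf u(t)$ and $\mathbf u^{\xi}_R(t)=\chi_R\,\mathbf u(t)^{\xi(t)}$, one has $\mathbf u^\xi_R(t)\in\mathrm H^1$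 for all $t$, $$\sup_{t\in\mathbb R}M(\mathbf u^{\xi}_R(t))\,K(\mathbf u^{\xi}_R(t))<(1-\delta)\,M(\mathbf Q)K(\mathbf Q),$$ and $$4K(\mathbf u^{\xi}_R(t))-5V(\mathbf u_R(t))\ \ge\ \delta' K(\mathbf u^{\xi}_R(t))\qquad\text{for all }t\in\mathbb R.$$ -/

import Mathlib

open MeasureTheory
open scoped ContDiff RealInnerProductSpace

namespace NLSSystem

noncomputable section

/-- Physical space `ℝ⁵` with the Euclidean norm. -/
abbrev E5 : Type := EuclideanSpace ℝ (Fin 5)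

/-- Triples `(u¹, u², u³)` of complex functions on `ℝ⁵`, with indices `0, 1, 2`. -/
abbrev Triple : Type := Fin 3 → E5 → ℂ

/-- The classical partial derivative `∂_j η` of a real test function. -/
def partialDeriv (j : Fin 5) (η : E5 → ℝ) (x : E5) : ℝ :=
  fderiv ℝ η x (EuclideanSpace.single j 1)

/-- Test functions: smooth and compactly supported. -/
def IsTest (η : E5 → ℝ) : Prop := ContDiff ℝ ∞ η ∧ HasCompactSupport η

/-- `v` is the `j`-th weak partial derivative of `u`. (Used for locally integrable `u`, `v`.) -/
def HasWeakPartial (j : Fin 5) (u v : E5 → ℂ) : Prop :=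
  ∀ η : E5 → ℝ, IsTest η →
    ∫ x, (partialDeriv j η x : ℂ) * u x = - ∫ x, (η x : ℂ) * v x

/-- The Sobolev space `H¹(ℝ⁵)`: `u` and all its first weak partial derivatives are in `L²`. -/
def MemH1 (u : E5 → ℂ) : Prop :=
  MemLp u 2 volume ∧ ∀ j : Fin 5, ∃ v : E5 → ℂ, MemLp v 2 volume ∧ HasWeakPartial j u v

open Classical in
/-- A representative of the `j`-th weak partial derivative of an `H¹` function
(unique up to null sets; zero by convention if there is none in `L²`). -/
def weakPartial (j : Fin 5) (u : E5 → ℂ) : E5 → ℂ :=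
  if h : ∃ v : E5 → ℂ, MemLp v 2 volume ∧ HasWeakPartial j u v then h.choose else 0

/-- `H¹ × H¹ × H¹`. -/
def MemH1Triple (u : Triple) : Prop := ∀ i, MemH1 (u i)

/-- `‖f‖²_{L²}`. -/
def normSqL2 (f : E5 → ℂ) : ℝ := ∫ x, ‖f x‖ ^ 2

/-- `‖f‖²_{Ḣ¹} = ∫ |∇ f|²`. -/
def normSqH1dot (f : E5 → ℂ) : ℝ := ∑ j, normSqL2 (weakPartial j f)

/-- Mass `M(u) = ½‖u¹‖² + ½‖u²‖² + ‖u³‖²`. -/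
def mass (u : Triple) : ℝ :=
  1 / 2 * normSqL2 (u 0) + 1 / 2 * normSqL2 (u 1) + normSqL2 (u 2)

/-- Kinetic energy `K(u) = ∑ᵢ (κᵢ/2) ‖uⁱ‖²_{Ḣ¹}`. -/
def kinetic (κ : Fin 3 → ℝ) (u : Triple) : ℝ := ∑ i, κ i / 2 * normSqH1dot (u i)

/-- Potential energy `V(u) = Re ∫ conj(u¹) conj(u²) u³`. -/
def potential (u : Triple) : ℝ :=
  (∫ x, (starRingEnd ℂ) (u 0 x) * (starRingEnd ℂ) (u 1 x) * u 2 x).re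

/-- The Weinstein functional `J(u) = M(u)^{1/2} K(u)^{5/2} V(u)^{-2}` (for `V(u) ≠ 0`). -/
def weinstein (κ : Fin 3 → ℝ) (u : Triple) : ℝ :=
  mass u ^ (1 / 2 : ℝ) * kinetic κ u ^ (5 / 2 : ℝ) / potential u ^ 2

/-- The set `Ξ` of `H¹` triples with `V ≠ 0`. -/
def MemXi (u : Triple) : Prop := MemH1Triple u ∧ potential u ≠ 0

/-- `f` is (a.e.) a real, non-negative, radial function. -/
def IsNonnegRadial (f : E5 → ℂ) : Prop :=
  ∃ g : ℝ → ℝ, (∀ r, 0 ≤ g r) ∧ ∀ᵐ x : E5, f x = (g ‖x‖ : ℂ)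

/-- `φ` is a weak `H¹` solution of `c φ - κ Δ φ = F`. -/
def IsWeakEllipticSol (c κ : ℝ) (φ F : E5 → ℂ) : Prop :=
  ∀ η : E5 → ℝ, IsTest η →
    (c : ℂ) * (∫ x, (η x : ℂ) * φ x)
        + (κ : ℂ) * ∑ j, ∫ x, (partialDeriv j η x : ℂ) * weakPartial j φ x
      = ∫ x, (η x : ℂ) * F x

/-- Ground states `Q = (φ₁, φ₂, φ₃)`: non-negative radial triples in `Ξ` that solve
`φ₁ - κ₁Δφ₁ = φ₂φ₃`, `φ₂ - κ₂Δφ₂ = φ₁φ₃`, `2φ₃ - κ₃Δφ₃ = φ₁φ₂`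
and at which the Weinstein functional takes its minimal value `J(Q) = J_min`. -/
structure IsGroundState (κ : Fin 3 → ℝ) (Q : Triple) : Prop where
  memXi : MemXi Q
  nonneg_radial : ∀ i, IsNonnegRadial (Q i)
  eq_one : IsWeakEllipticSol 1 (κ 0) (Q 0) (fun x => Q 1 x * Q 2 x)
  eq_two : IsWeakEllipticSol 1 (κ 1) (Q 1) (fun x => Q 0 x * Q 2 x)
  eq_three : IsWeakEllipticSol 2 (κ 2) (Q 2) (fun x => Q 0 x * Q 1 x)
  minimal : ∀ u : Triple, MemXi u → weinstein κ Q ≤ weinstein κ u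

/-- The Galilean boost `u^ξ`, with components `e^{i x·ξ/κᵢ} uⁱ(x)`. -/
def boost (κ : Fin 3 → ℝ) (ξ : E5) (u : Triple) : Triple :=
  fun i x => Complex.exp (Complex.I * ((⟪x, ξ⟫ / κ i : ℝ) : ℂ)) * u i x

/-- The smooth radially decreasing profile `χ`, equal to `1` for `|x| ≤ 1 - ε` and
to `0` for `|x| > 1`. -/
structure IsCutoff (ε : ℝ) (χ : E5 → ℝ) : Prop where
  eps_pos : 0 < ε
  eps_lt_one : ε < 1
  smooth : ContDiff ℝ ∞ χ
  radial_antitone : ∀ x y, ‖x‖ ≤ ‖y‖ → χ y ≤ χ x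
  eq_one : ∀ x, ‖x‖ ≤ 1 - ε → χ x = 1
  eq_zero : ∀ x, 1 < ‖x‖ → χ x = 0

/-- The cutoff `χ((x - s)/R)` on the ball of radius `R` around `s`. -/
def cutoffAt (χ : E5 → ℝ) (s : E5) (R : ℝ) (x : E5) : ℝ := χ (R⁻¹ • (x - s))

/-- Multiplication of a triple by a real function. -/
def localize (ρ : E5 → ℝ) (u : Triple) : Triple := fun i x => (ρ x : ℂ) * u i x

/-- The localized momentum `∫ Im(∑ᵢ conj(uⁱ) ∇uⁱ) ρ²`. -/
def localMomentum (ρ : E5 → ℝ) (u : Triple) : E5 :=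
  WithLp.toLp 2 fun j =>
    ∫ x, (∑ i, (starRingEnd ℂ) (u i x) * weakPartial j (u i) x).im * ρ x ^ 2

/-- `∫ (κ₂κ₃|u¹|² + κ₁κ₃|u²|² + κ₁κ₂|u³|²) ρ²`. -/
def localWeight (κ : Fin 3 → ℝ) (ρ : E5 → ℝ) (u : Triple) : ℝ :=
  ∫ x, (κ 1 * κ 2 * ‖u 0 x‖ ^ 2 + κ 0 * κ 2 * ‖u 1 x‖ ^ 2 + κ 0 * κ 1 * ‖u 2 x‖ ^ 2) * ρ x ^ 2

open Classical in
/-- The frequency `ξ` attached to the localization `ρ`: minus `κ₁κ₂κ₃` times the localized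
momentum, divided by the localized weight, and `0` if the weight vanishes. -/
def xi (κ : Fin 3 → ℝ) (ρ : E5 → ℝ) (u : Triple) : E5 :=
  if localWeight κ ρ u = 0 then 0
  else -((κ 0 * κ 1 * κ 2 / localWeight κ ρ u) • localMomentum ρ u)

/-- The localized boosted triple `χ((x - s)/R) u^ξ(x)`, where `ξ` is computed from `u` with
the same `s` and `R`. -/
def localBoost (κ : Fin 3 → ℝ) (χ : E5 → ℝ) (s : E5) (R : ℝ) (u : Triple) : Triple :=
  localize (cutoffAt χ s R) (boost κ (xi κ (cutoffAt χ s R) u) u)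

end

end NLSSystem

/-!
The heart of the matter is the inequality `5 V(u) ≤ 4 θ K(u)` whenever
`M(u) K(u) ≤ θ⁴ M(Q) K(Q)` (`IsGroundState.potential_le`). Minimality of `J` at `Q` gives
`V(u)⁴ ≤ C M(u) K(u)⁵` with the constant `C = V(Q)⁴ / (M(Q) K(Q)⁵)`, and the Pohozaev identity
`5 V(Q) = 4 K(Q)` evaluates it. No Sobolev embedding enters: `V(u) = 0` is harmless, and
`V(Q) ≠ 0` already forces the integrand of `V(Q)` to be integrable.

The Pohozaev identity (`IsGroundState.pohozaev`) is obtained without regularity or decay of `Q`.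
Varying `φ₁` alone by a test function, minimality of `J² = M K⁵ / V⁴` yields an Euler–Lagrange
equation, and the ground state system yields a second equation with the same nonlinear term. If
`5 V(Q) ≠ 4 K(Q)`, eliminating this term leaves `Δφ₁ = ν φ₁` with a constant `ν`. A nonnegative
`L²` function on `ℝ⁵` with this property vanishes (`ae_eq_zero_of_lap_eq`): test the equation with
a truncation of `G = 1 / (1 + c |x|²)`, where `c` is chosen such that `ΔG - ν G` has a strict sign.
The same fact shows `K(Q) > 0`.

A boost keeps `M`, and it keeps `V` by mass resonance. This gives the coercivity of boosted
functions, with `δ' = 4 (1 - (1 - δ)^(1/4))`. On balls, `K(χ_R u^ξ)` is a quadratic polynomial in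
`ξ` that attains its minimum at the frequency `ξ(t)` (`kinetic_boost_xi_le`), so it is at most
`K(χ_R u) ≤ (1 + θ) K(u) + C_θ R⁻² M(u)`, and the gap between `δ` and `δ₀` absorbs the excess for
large `R`.
-/

namespace NLSSystem

/-! ### Test functions and weak derivatives -/

theorem IsTest.continuous {η : E5 → ℝ} (h : IsTest η) : Continuous η := h.1.continuous

theorem IsTest.memLp {η : E5 → ℝ} (h : IsTest η) (p : ENNReal) : MemLp η p volume :=
  h.continuous.memLp_of_hasCompactSupport h.2

theorem contDiff_partialDeriv {η : E5 → ℝ} (h : ContDiff ℝ ∞ η) (j : Fin 5) :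
    ContDiff ℝ ∞ (partialDeriv j η) :=
  (h.fderiv_right (m := ∞) (by simp)).clm_apply contDiff_const

theorem IsTest.partialDeriv {η : E5 → ℝ} (h : IsTest η) (j : Fin 5) :
    IsTest (partialDeriv j η) :=
  ⟨contDiff_partialDeriv h.1 j, h.2.fderiv_apply (𝕜 := ℝ) _⟩

theorem IsTest.mul_left {η a : E5 → ℝ} (h : IsTest η) (ha : ContDiff ℝ ∞ a) :
    IsTest (fun x => a x * η x) :=
  ⟨ha.mul h.1, h.2.mul_left⟩

theorem IsTest.ofReal_memLp {η : E5 → ℝ} (h : IsTest η) :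
    MemLp (fun x => (η x : ℂ)) 2 volume := (h.memLp 2).ofReal

theorem differentiable_of_contDiff {a : E5 → ℝ} (ha : ContDiff ℝ ∞ a) : Differentiable ℝ a :=
  ha.differentiable (by simp)

theorem partialDeriv_mul {a b : E5 → ℝ} (ha : ContDiff ℝ ∞ a) (hb : ContDiff ℝ ∞ b)
    (j : Fin 5) (x : E5) :
    partialDeriv j (fun x => a x * b x) x = a x * partialDeriv j b x + partialDeriv j a x * b x := by
  unfold partialDeriv
  rw [fderiv_fun_mul (differentiable_of_contDiff ha x) (differentiable_of_contDiff hb x)]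
  simp
  ring

theorem integrable_mul_of_memLp_two {f g : E5 → ℂ} (hf : MemLp f 2 volume)
    (hg : MemLp g 2 volume) : Integrable (fun x => f x * g x) := hf.integrable_mul hg

theorem integrable_normSq_of_memLp_two {f : E5 → ℂ} (hf : MemLp f 2 volume) :
    Integrable (fun x => ‖f x‖ ^ 2) := (memLp_two_iff_integrable_sq_norm hf.1).1 hf

theorem IsTest.integrable_mul {η : E5 → ℝ} (h : IsTest η) {u : E5 → ℂ} (hu : MemLp u 2 volume) :
    Integrable (fun x => (η x : ℂ) * u x) := integrable_mul_of_memLp_two h.ofReal_memLp hu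

/-- Multiplication by a bounded continuous real function preserves `L²`. -/
theorem memLp_ofReal_mul {a : E5 → ℝ} (ha : Continuous a) {C : ℝ} (hC : ∀ x, |a x| ≤ C)
    {u : E5 → ℂ} (hu : MemLp u 2 volume) : MemLp (fun x => (a x : ℂ) * u x) 2 volume := by
  refine (hu.norm.const_mul C).mono
    ((Complex.continuous_ofReal.comp ha).aestronglyMeasurable.mul hu.1) (ae_of_all _ fun x => ?_)
  have h0 : 0 ≤ C := (abs_nonneg _).trans (hC x)
  simp only [norm_mul, Complex.norm_real, Real.norm_eq_abs, abs_norm, abs_of_nonneg h0]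
  exact mul_le_mul_of_nonneg_right (hC x) (norm_nonneg _)

/-- An `L²` weak partial derivative is unique up to null sets. -/
theorem HasWeakPartial.ae_unique {j : Fin 5} {u v w : E5 → ℂ} (hv : HasWeakPartial j u v)
    (hw : HasWeakPartial j u w) (hv2 : MemLp v 2 volume) (hw2 : MemLp w 2 volume) :
    v =ᵐ[volume] w := by
  refine ae_eq_of_integral_contDiff_smul_eq (hv2.locallyIntegrable (by norm_num))
    (hw2.locallyIntegrable (by norm_num)) fun g hg hgs => ?_
  have h := (hv g ⟨hg, hgs⟩).symm.trans (hw g ⟨hg, hgs⟩)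
  simpa [Complex.real_smul] using h

theorem HasWeakPartial.add {j : Fin 5} {u v u' v' : E5 → ℂ} (h : HasWeakPartial j u v)
    (h' : HasWeakPartial j u' v') (hu : MemLp u 2 volume) (hv : MemLp v 2 volume)
    (hu' : MemLp u' 2 volume) (hv' : MemLp v' 2 volume) :
    HasWeakPartial j (fun x => u x + u' x) (fun x => v x + v' x) := by
  intro η hη
  simp only [mul_add]
  rw [integral_add ((hη.partialDeriv j).integrable_mul hu) ((hη.partialDeriv j).integrable_mul hu'),
    integral_add (hη.integrable_mul hv) (hη.integrable_mul hv'), h η hη, h' η hη]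
  ring

theorem HasWeakPartial.const_mul {j : Fin 5} {u v : E5 → ℂ} (h : HasWeakPartial j u v) (c : ℂ) :
    HasWeakPartial j (fun x => c * u x) (fun x => c * v x) := by
  intro η hη
  simp only [mul_left_comm _ c]
  rw [integral_const_mul, integral_const_mul, h η hη]
  ring

/-- Leibniz rule for the product of an `L²` function with a smooth real function. -/
theorem HasWeakPartial.smooth_mul {j : Fin 5} {u v : E5 → ℂ} (h : HasWeakPartial j u v)
    (hu : MemLp u 2 volume) (hv : MemLp v 2 volume) {a : E5 → ℝ} (ha : ContDiff ℝ ∞ a) :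
    HasWeakPartial j (fun x => (a x : ℂ) * u x)
      (fun x => (a x : ℂ) * v x + (partialDeriv j a x : ℂ) * u x) := by
  intro η hη
  have h1 := h _ (hη.mul_left ha)
  have hi1 := ((hη.partialDeriv j).mul_left ha).integrable_mul hu
  have hi2 := (hη.mul_left (contDiff_partialDeriv ha j)).integrable_mul hu
  have hi3 := (hη.mul_left ha).integrable_mul hv
  simp only [partialDeriv_mul ha hη.1] at h1
  have e1 : ∫ x, (partialDeriv j η x : ℂ) * ((a x : ℂ) * u x)
      = ∫ x, ((a x * partialDeriv j η x : ℝ) : ℂ) * u x := by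
    congr 1; ext x; push_cast; ring
  have e2 : ∫ x, (η x : ℂ) * ((a x : ℂ) * v x + (partialDeriv j a x : ℂ) * u x)
      = (∫ x, ((a x * η x : ℝ) : ℂ) * v x) + ∫ x, ((partialDeriv j a x * η x : ℝ) : ℂ) * u x := by
    rw [← integral_add hi3 hi2]
    congr 1; ext x; push_cast; ring
  have e3 : ∫ x, ((a x * partialDeriv j η x + partialDeriv j a x * η x : ℝ) : ℂ) * u x
      = (∫ x, ((a x * partialDeriv j η x : ℝ) : ℂ) * u x)
        + ∫ x, ((partialDeriv j a x * η x : ℝ) : ℂ) * u x := by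
    rw [← integral_add hi1 hi2]
    congr 1; ext x; push_cast; ring
  rw [e1, e2]
  rw [e3] at h1
  linear_combination h1

theorem IsTest.hasWeakPartial {η : E5 → ℝ} (h : IsTest η) (j : Fin 5) :
    HasWeakPartial j (fun x => (η x : ℂ)) (fun x => (NLSSystem.partialDeriv j η x : ℂ)) := by
  intro ζ hζ
  have key : ∫ x, η x * NLSSystem.partialDeriv j ζ x = - ∫ x, NLSSystem.partialDeriv j η x * ζ x :=
    integral_mul_fderiv_eq_neg_fderiv_mul_of_integrable
      (((h.partialDeriv j).memLp 2).integrable_mul (hζ.memLp 2))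
      ((h.memLp 2).integrable_mul ((hζ.partialDeriv j).memLp 2))
      ((h.memLp 2).integrable_mul (hζ.memLp 2))
      (fun x _ => differentiable_of_contDiff h.1 x) (fun x _ => differentiable_of_contDiff hζ.1 x)
  simp only [← Complex.ofReal_mul, integral_complex_ofReal]
  rw [← Complex.ofReal_neg, Complex.ofReal_inj]
  simpa only [mul_comm] using key

theorem MemH1.memLp_weakPartial {u : E5 → ℂ} (h : MemH1 u) (j : Fin 5) :
    MemLp (weakPartial j u) 2 volume := by
  unfold weakPartial
  rw [dif_pos (h.2 j)]
  exact (h.2 j).choose_spec.1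

theorem MemH1.hasWeakPartial_weakPartial {u : E5 → ℂ} (h : MemH1 u) (j : Fin 5) :
    HasWeakPartial j u (weakPartial j u) := by
  unfold weakPartial
  rw [dif_pos (h.2 j)]
  exact (h.2 j).choose_spec.2

theorem weakPartial_ae_eq {j : Fin 5} {u v : E5 → ℂ} (hv : MemLp v 2 volume)
    (h : HasWeakPartial j u v) : weakPartial j u =ᵐ[volume] v := by
  have hex : ∃ v : E5 → ℂ, MemLp v 2 volume ∧ HasWeakPartial j u v := ⟨v, hv, h⟩
  unfold weakPartial
  rw [dif_pos hex]
  exact hex.choose_spec.2.ae_unique h hex.choose_spec.1 hv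

theorem normSqL2_congr {f g : E5 → ℂ} (h : f =ᵐ[volume] g) : normSqL2 f = normSqL2 g :=
  integral_congr_ae (h.mono fun x hx => by simp [hx])

theorem normSqL2_nonneg (f : E5 → ℂ) : 0 ≤ normSqL2 f := integral_nonneg fun _ => by positivity

theorem normSqH1dot_nonneg (f : E5 → ℂ) : 0 ≤ normSqH1dot f :=
  Finset.sum_nonneg fun _ _ => normSqL2_nonneg _

theorem mass_nonneg (u : Triple) : 0 ≤ mass u := by
  have := normSqL2_nonneg (u 0)
  have := normSqL2_nonneg (u 1)
  have := normSqL2_nonneg (u 2)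
  unfold mass
  linarith

theorem kinetic_nonneg {κ : Fin 3 → ℝ} (hκ : ∀ i, 0 < κ i) (u : Triple) : 0 ≤ kinetic κ u :=
  Finset.sum_nonneg fun i _ => mul_nonneg (by linarith [hκ i]) (normSqH1dot_nonneg _)

/-- A smooth function that is bounded together with its first partial derivatives, the
multipliers of `H¹` that are needed. -/
structure IsMultiplier (a : E5 → ℝ) : Prop where
  smooth : ContDiff ℝ ∞ a
  bounded : ∃ C, ∀ x, |a x| ≤ C
  bounded_partial : ∀ j, ∃ C, ∀ x, |partialDeriv j a x| ≤ C

theorem IsMultiplier.memLp_mul {a : E5 → ℝ} (ha : IsMultiplier a) {u : E5 → ℂ}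
    (hu : MemLp u 2 volume) : MemLp (fun x => (a x : ℂ) * u x) 2 volume :=
  memLp_ofReal_mul ha.smooth.continuous ha.bounded.choose_spec hu

theorem IsMultiplier.memLp_leibniz {a : E5 → ℝ} (ha : IsMultiplier a) {u v : E5 → ℂ}
    (hu : MemLp u 2 volume) (hv : MemLp v 2 volume) (j : Fin 5) :
    MemLp (fun x => (a x : ℂ) * v x + (partialDeriv j a x : ℂ) * u x) 2 volume :=
  (ha.memLp_mul hv).add (memLp_ofReal_mul (contDiff_partialDeriv ha.smooth j).continuous
    (ha.bounded_partial j).choose_spec hu)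

theorem MemH1.ofReal_mul {u : E5 → ℂ} (h : MemH1 u) {a : E5 → ℝ} (ha : IsMultiplier a) :
    MemH1 (fun x => (a x : ℂ) * u x) :=
  ⟨ha.memLp_mul h.1, fun j => ⟨_, ha.memLp_leibniz h.1 (h.memLp_weakPartial j) j,
    (h.hasWeakPartial_weakPartial j).smooth_mul h.1 (h.memLp_weakPartial j) ha.smooth⟩⟩

theorem MemH1.weakPartial_ofReal_mul {u : E5 → ℂ} (h : MemH1 u) {a : E5 → ℝ}
    (ha : IsMultiplier a) (j : Fin 5) :
    weakPartial j (fun x => (a x : ℂ) * u x) =ᵐ[volume]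
      fun x => (a x : ℂ) * weakPartial j u x + (partialDeriv j a x : ℂ) * u x :=
  weakPartial_ae_eq (ha.memLp_leibniz h.1 (h.memLp_weakPartial j) j)
    ((h.hasWeakPartial_weakPartial j).smooth_mul h.1 (h.memLp_weakPartial j) ha.smooth)

theorem MemH1.add {u v : E5 → ℂ} (hu : MemH1 u) (hv : MemH1 v) : MemH1 (fun x => u x + v x) :=
  ⟨hu.1.add hv.1, fun j => ⟨_, (hu.memLp_weakPartial j).add (hv.memLp_weakPartial j),
    (hu.hasWeakPartial_weakPartial j).add (hv.hasWeakPartial_weakPartial j) hu.1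
      (hu.memLp_weakPartial j) hv.1 (hv.memLp_weakPartial j)⟩⟩

theorem MemH1.weakPartial_add {u v : E5 → ℂ} (hu : MemH1 u) (hv : MemH1 v) (j : Fin 5) :
    weakPartial j (fun x => u x + v x) =ᵐ[volume] fun x => weakPartial j u x + weakPartial j v x :=
  weakPartial_ae_eq ((hu.memLp_weakPartial j).add (hv.memLp_weakPartial j))
    ((hu.hasWeakPartial_weakPartial j).add (hv.hasWeakPartial_weakPartial j) hu.1
      (hu.memLp_weakPartial j) hv.1 (hv.memLp_weakPartial j))

theorem MemH1.const_mul {u : E5 → ℂ} (hu : MemH1 u) (c : ℂ) : MemH1 (fun x => c * u x) :=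
  ⟨hu.1.const_mul c, fun j => ⟨_, (hu.memLp_weakPartial j).const_mul c,
    (hu.hasWeakPartial_weakPartial j).const_mul c⟩⟩

theorem MemH1.weakPartial_const_mul {u : E5 → ℂ} (hu : MemH1 u) (c : ℂ) (j : Fin 5) :
    weakPartial j (fun x => c * u x) =ᵐ[volume] fun x => c * weakPartial j u x :=
  weakPartial_ae_eq ((hu.memLp_weakPartial j).const_mul c)
    ((hu.hasWeakPartial_weakPartial j).const_mul c)

theorem IsTest.memH1 {η : E5 → ℝ} (h : IsTest η) : MemH1 (fun x => (η x : ℂ)) :=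
  ⟨h.ofReal_memLp, fun j => ⟨_, (h.partialDeriv j).ofReal_memLp, h.hasWeakPartial j⟩⟩

theorem IsTest.weakPartial_ae_eq {η : E5 → ℝ} (h : IsTest η) (j : Fin 5) :
    weakPartial j (fun x => (η x : ℂ)) =ᵐ[volume] fun x => (NLSSystem.partialDeriv j η x : ℂ) :=
  NLSSystem.weakPartial_ae_eq (h.partialDeriv j).ofReal_memLp (h.hasWeakPartial j)

/-! ### Partial derivatives of rescaled cutoffs and of `1 / (1 + c |x|²)` -/

theorem contDiff_cutoffAt {χ : E5 → ℝ} (h : ContDiff ℝ ∞ χ) (s : E5) (R : ℝ) :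
    ContDiff ℝ ∞ (cutoffAt χ s R) :=
  h.comp ((contDiff_id.sub contDiff_const).const_smul R⁻¹)

theorem partialDeriv_cutoffAt {χ : E5 → ℝ} (h : ContDiff ℝ ∞ χ) (s : E5) (R : ℝ) (j : Fin 5) :
    partialDeriv j (cutoffAt χ s R) = fun x => R⁻¹ * cutoffAt (partialDeriv j χ) s R x := by
  ext x
  have h1 : HasFDerivAt (fun y : E5 => R⁻¹ • (y - s)) (R⁻¹ • ContinuousLinearMap.id ℝ E5) x :=
    ((hasFDerivAt_id x).sub_const s).const_smul R⁻¹
  have h2 := (differentiable_of_contDiff h (R⁻¹ • (x - s))).hasFDerivAt.comp x h1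
  have h3 : fderiv ℝ (cutoffAt χ s R) x = _ := h2.fderiv
  unfold partialDeriv
  rw [h3]
  simp [cutoffAt]

theorem partialDeriv_const_mul {a : E5 → ℝ} (ha : ContDiff ℝ ∞ a) (c : ℝ) (j : Fin 5) (x : E5) :
    partialDeriv j (fun x => c * a x) x = c * partialDeriv j a x := by
  unfold partialDeriv
  rw [fderiv_const_mul (differentiable_of_contDiff ha x)]
  simp

theorem partialDeriv_add {a b : E5 → ℝ} (ha : ContDiff ℝ ∞ a) (hb : ContDiff ℝ ∞ b)
    (j : Fin 5) (x : E5) :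
    partialDeriv j (a + b) x = partialDeriv j a x + partialDeriv j b x := by
  unfold partialDeriv
  rw [fderiv_add (differentiable_of_contDiff ha x) (differentiable_of_contDiff hb x)]
  rfl

/-- The Laplacian `∑ⱼ ∂ⱼ∂ⱼ η`. -/
noncomputable def lap (η : E5 → ℝ) (x : E5) : ℝ := ∑ j, partialDeriv j (partialDeriv j η) x

theorem lap_mul {a b : E5 → ℝ} (ha : ContDiff ℝ ∞ a) (hb : ContDiff ℝ ∞ b) (x : E5) :
    lap (fun x => a x * b x) x
      = a x * lap b x + (2 * ∑ j, partialDeriv j a x * partialDeriv j b x + lap a x * b x) := by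
  have key : ∀ j, partialDeriv j (partialDeriv j fun x => a x * b x) x
      = a x * partialDeriv j (partialDeriv j b) x
        + (2 * (partialDeriv j a x * partialDeriv j b x)
          + partialDeriv j (partialDeriv j a) x * b x) := by
    intro j
    have e : (partialDeriv j fun x => a x * b x)
        = (fun x => a x * partialDeriv j b x) + fun x => partialDeriv j a x * b x := by
      ext y; exact partialDeriv_mul ha hb j y
    have c1 := contDiff_partialDeriv ha j
    have c2 := contDiff_partialDeriv hb j
    rw [e, partialDeriv_add (ha.mul c2) (c1.mul hb), partialDeriv_mul ha c2, partialDeriv_mul c1 hb]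
    ring
  unfold lap
  simp only [key, Finset.sum_add_distrib, Finset.mul_sum, Finset.sum_mul]

theorem IsTest.lap {η : E5 → ℝ} (h : IsTest η) : IsTest (lap η) := by
  have key : ∀ s : Finset (Fin 5), IsTest (fun x => ∑ j ∈ s,
      NLSSystem.partialDeriv j (NLSSystem.partialDeriv j η) x) := by
    intro s
    induction s using Finset.induction_on with
    | empty => simpa using ⟨contDiff_const, HasCompactSupport.zero⟩
    | insert j s hj ih =>
      simp only [Finset.sum_insert hj]
      exact ⟨((h.partialDeriv j).partialDeriv j).1.add ih.1,
        ((h.partialDeriv j).partialDeriv j).2.add ih.2⟩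
  exact key Finset.univ

theorem lap_cutoffAt {χ : E5 → ℝ} (h : ContDiff ℝ ∞ χ) (s : E5) (R : ℝ) (x : E5) :
    lap (cutoffAt χ s R) x = R⁻¹ ^ 2 * cutoffAt (lap χ) s R x := by
  have key : ∀ j, partialDeriv j (partialDeriv j (cutoffAt χ s R)) x
      = R⁻¹ ^ 2 * cutoffAt (partialDeriv j (partialDeriv j χ)) s R x := by
    intro j
    rw [partialDeriv_cutoffAt h, partialDeriv_const_mul
      (contDiff_cutoffAt (contDiff_partialDeriv h j) s R),
      partialDeriv_cutoffAt (contDiff_partialDeriv h j)]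
    ring
  simp only [lap, key, ← Finset.mul_sum, cutoffAt]

/-- The comparison function `1 / (1 + c |x|²)`. -/
noncomputable def bubble (c : ℝ) (x : E5) : ℝ := (1 + c * ‖x‖ ^ 2)⁻¹

section Bubble

variable {c : ℝ}

theorem bubble_pos (hc : 0 < c) (x : E5) : 0 < bubble c x := by
  unfold bubble; positivity

theorem contDiff_bubble (hc : 0 < c) : ContDiff ℝ ∞ (bubble c) :=
  (contDiff_const.add (contDiff_const.mul (contDiff_norm_sq ℝ))).inv
    fun x => by positivity

theorem partialDeriv_bubble (hc : 0 < c) (j : Fin 5) :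
    partialDeriv j (bubble c) = fun x => (-2 * c) * (x j * (bubble c x * bubble c x)) := by
  ext x
  have h1 : HasFDerivAt (fun y : E5 => 1 + c * ‖y‖ ^ 2) (c • (2 • innerSL ℝ x)) x :=
    ((hasStrictFDerivAt_norm_sq x).hasFDerivAt.const_mul c).const_add 1
  have hne : 1 + c * ‖x‖ ^ 2 ≠ 0 := by positivity
  have h2 := (hasDerivAt_inv hne).comp_hasFDerivAt x h1
  have h3 : fderiv ℝ (bubble c) x = _ := h2.fderiv
  unfold partialDeriv
  rw [h3]
  simp [bubble, EuclideanSpace.inner_single_right]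
  field_simp

theorem contDiff_coord (j : Fin 5) : ContDiff ℝ ∞ (fun x : E5 => x j) :=
  (EuclideanSpace.proj (𝕜 := ℝ) j).contDiff

theorem partialDeriv_coord (j : Fin 5) (x : E5) : partialDeriv j (fun x : E5 => x j) x = 1 := by
  have h : fderiv ℝ (fun x : E5 => x j) x = EuclideanSpace.proj (𝕜 := ℝ) j :=
    (EuclideanSpace.proj (𝕜 := ℝ) j).hasFDerivAt.fderiv
  unfold partialDeriv
  rw [h]
  simp

theorem lap_bubble (hc : 0 < c) (x : E5) :
    lap (bubble c) x = -(c * (10 + 2 * (c * ‖x‖ ^ 2)) * bubble c x ^ 3) := by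
  have hb := contDiff_bubble hc
  have key : ∀ j, partialDeriv j (partialDeriv j (bubble c)) x
      = -2 * c * bubble c x ^ 2 + 8 * c ^ 2 * bubble c x ^ 3 * x j ^ 2 := by
    intro j
    rw [partialDeriv_bubble hc, partialDeriv_const_mul ((contDiff_coord j).mul (hb.mul hb)),
      partialDeriv_mul (contDiff_coord j) (hb.mul hb), partialDeriv_mul hb hb,
      partialDeriv_coord, partialDeriv_bubble hc]
    ring
  have hn : ∑ j, x j ^ 2 = ‖x‖ ^ 2 := by
    simp [EuclideanSpace.norm_sq_eq]
  have hne : bubble c x * (1 + c * ‖x‖ ^ 2) = 1 := inv_mul_cancel₀ (by positivity)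
  simp only [lap, key, Finset.sum_add_distrib, ← Finset.mul_sum, hn, Finset.sum_const,
    Finset.card_univ, Fintype.card_fin, nsmul_eq_mul]
  push_cast
  linear_combination (10 * c * bubble c x ^ 2) * hne

theorem bubble_le (hc : 0 < c) (x : E5) :
    bubble c x ≤ 2 * (1 + c⁻¹) * ((1 + ‖x‖) ^ 2)⁻¹ := by
  unfold bubble
  rw [inv_eq_one_div, ← div_eq_mul_inv, div_le_div_iff₀ (by positivity) (by positivity)]
  have h : c⁻¹ * c = 1 := inv_mul_cancel₀ hc.ne'
  have h1 : 2 * (1 + c⁻¹) * (1 + c * ‖x‖ ^ 2)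
    = 2 * (1 + ‖x‖ ^ 2) + 2 * c⁻¹ + 2 * c * ‖x‖ ^ 2 := by linear_combination 2 * ‖x‖ ^ 2 * h
  have : 0 ≤ 2 * c⁻¹ + 2 * c * ‖x‖ ^ 2 := by positivity
  rw [h1]
  nlinarith [sq_nonneg (1 - ‖x‖)]

end Bubble

/-! ### A Liouville theorem for nonnegative square-integrable functions -/

/-- The commutator `Δ(θ_R G) - θ_R ΔG` for the comparison function `G` and `θ_R = θ(·/R)`. -/
noncomputable def cutoffError (c : ℝ) (θ : E5 → ℝ) (R : ℝ) (x : E5) : ℝ :=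
  2 * ∑ j, partialDeriv j (cutoffAt θ 0 R) x * partialDeriv j (bubble c) x
    + lap (cutoffAt θ 0 R) x * bubble c x

theorem exists_bound_of_test {η : E5 → ℝ} (h : IsTest η) : ∃ C, 0 ≤ C ∧ ∀ x, |η x| ≤ C := by
  obtain ⟨C, hC⟩ := h.continuous.bounded_above_of_compact_support h.2
  exact ⟨C, (norm_nonneg _).trans (hC 0), hC⟩

/-- The commutator terms are `O(R⁻¹ (1 + |x|)⁻³)`; the weight `(1 + |x|)⁻³` is in `L²(ℝ⁵)`. -/
theorem exists_cutoffError_le {c : ℝ} (hc : 0 < c) {θ : E5 → ℝ} (hθ : IsTest θ)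
    (hsupp : ∀ x, 2 < ‖x‖ → θ x = 0) :
    ∃ C, 0 ≤ C ∧ ∀ R, 1 ≤ R → ∀ x, |cutoffError c θ R x| ≤ C / R * ((1 + ‖x‖) ^ 3)⁻¹ := by
  choose A hA0 hA using fun j => exists_bound_of_test (hθ.partialDeriv j)
  obtain ⟨B, hB0, hB⟩ := exists_bound_of_test hθ.lap
  set D := 2 * (1 + c⁻¹) with hD
  have hD0 : 0 ≤ D := by positivity
  refine ⟨2 * ∑ j, A j * (2 * c * D ^ 2) + B * 3 * D, ?_, fun R hR x => ?_⟩
  · have : 0 ≤ ∑ j, A j * (2 * c * D ^ 2) :=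
      Finset.sum_nonneg fun j _ => mul_nonneg (hA0 j) (by positivity)
    positivity
  have hR0 : 0 < R := by linarith
  have hx := norm_nonneg x
  set r := ‖x‖ with hr
  set w := (1 + r)⁻¹ with hw
  have hw0 : 0 < w := by positivity
  have hwr : w * (1 + r) = 1 := inv_mul_cancel₀ (by positivity)
  have hw3 : ((1 + r) ^ 3)⁻¹ = w ^ 3 := by simp [hw]
  have hb : bubble c x ≤ D * w ^ 2 := by simpa [hw] using bubble_le hc x
  have hbp := bubble_pos hc x
  have hwr1 : w * r ≤ 1 := by nlinarith
  have h1 : ∀ j, |partialDeriv j (cutoffAt θ 0 R) x * partialDeriv j (bubble c) x|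
      ≤ A j * (2 * c * D ^ 2) * (w ^ 3 / R) := by
    intro j
    rw [partialDeriv_cutoffAt hθ.1, partialDeriv_bubble hc]
    have e1 : |cutoffAt (partialDeriv j θ) 0 R x| ≤ A j := hA j _
    have e2 : |x j| ≤ r := by
      have := PiLp.norm_apply_le x j
      rwa [Real.norm_eq_abs] at this
    have e3 : |x j| * bubble c x ^ 2 ≤ D ^ 2 * w ^ 3 := by
      calc |x j| * bubble c x ^ 2 ≤ r * (D * w ^ 2) ^ 2 := by gcongr
        _ = D ^ 2 * w ^ 3 * (w * r) := by ring
        _ ≤ D ^ 2 * w ^ 3 := mul_le_of_le_one_right (by positivity) hwr1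
    calc |R⁻¹ * cutoffAt (partialDeriv j θ) 0 R x * ((-2 * c) * (x j * (bubble c x * bubble c x)))|
        = R⁻¹ * |cutoffAt (partialDeriv j θ) 0 R x| * (2 * c * (|x j| * bubble c x ^ 2)) := by
          simp only [abs_mul, abs_neg, abs_inv, abs_of_pos hR0, abs_of_pos hbp, abs_of_pos hc,
            abs_two]
          ring
      _ ≤ R⁻¹ * A j * (2 * c * (D ^ 2 * w ^ 3)) := by
          have := hA0 j
          gcongr
      _ = A j * (2 * c * D ^ 2) * (w ^ 3 / R) := by field_simp
  -- The factor `R⁻²` is traded for `R⁻¹ (1 + |x|)⁻¹` on the support `|x| ≤ 2R` of the cutoff.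
  have h2 : |lap (cutoffAt θ 0 R) x * bubble c x| ≤ B * 3 * D * (w ^ 3 / R) := by
    rw [lap_cutoffAt hθ.1]
    by_cases hxR : r ≤ 2 * R
    · have e1 : |cutoffAt (lap θ) 0 R x| ≤ B := hB _
      have e2 : w ^ 2 ≤ 3 * R * w ^ 3 := by
        have : 1 ≤ 3 * R * w := by nlinarith
        calc w ^ 2 = w ^ 2 * 1 := by ring
          _ ≤ w ^ 2 * (3 * R * w) := by gcongr
          _ = _ := by ring
      calc |R⁻¹ ^ 2 * cutoffAt (lap θ) 0 R x * bubble c x|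
          = R⁻¹ ^ 2 * |cutoffAt (lap θ) 0 R x| * bubble c x := by
            simp only [abs_mul, abs_pow, abs_inv, abs_of_pos hR0, abs_of_pos hbp]
        _ ≤ R⁻¹ ^ 2 * B * (D * (3 * R * w ^ 3)) := by
            gcongr
            exact hb.trans (by gcongr)
        _ = _ := by field_simp
    · have hz : cutoffAt (lap θ) 0 R x = 0 := by
        have hmem : R⁻¹ • (x - 0) ∈ (Metric.closedBall (0 : E5) 2)ᶜ := by
          simp only [sub_zero, Set.mem_compl_iff, Metric.mem_closedBall, dist_zero_right, norm_smul,
            norm_inv, Real.norm_eq_abs, abs_of_pos hR0, not_le]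
          rw [inv_mul_eq_div, lt_div_iff₀ hR0]
          linarith
        have hopen : IsOpen (Metric.closedBall (0 : E5) 2)ᶜ := Metric.isClosed_closedBall.isOpen_compl
        have hzero : ∀ y ∈ (Metric.closedBall (0 : E5) 2)ᶜ, θ y = 0 := fun y hy =>
          hsupp y (by simpa using hy)
        have hd : ∀ (η : E5 → ℝ), (∀ y ∈ (Metric.closedBall (0 : E5) 2)ᶜ, η y = 0) → ∀ j,
            ∀ y ∈ (Metric.closedBall (0 : E5) 2)ᶜ, partialDeriv j η y = 0 := by
          intro η hη j y hy
          have : η =ᶠ[nhds y] fun _ => 0 := Filter.eventually_of_mem (hopen.mem_nhds hy) hη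
          unfold partialDeriv
          rw [this.fderiv_eq]
          simp
        change lap θ _ = 0
        exact Finset.sum_eq_zero fun j _ => hd _ (hd _ hzero j) j _ hmem
      rw [hz]
      simp only [mul_zero, zero_mul, abs_zero]
      positivity
  rw [hw3]
  unfold cutoffError
  calc _ ≤ 2 * ∑ j, |partialDeriv j (cutoffAt θ 0 R) x * partialDeriv j (bubble c) x|
        + |lap (cutoffAt θ 0 R) x * bubble c x| := by
        refine (abs_add_le _ _).trans (add_le_add_left ?_ _)
        rw [abs_mul, abs_two]
        gcongr
        exact Finset.abs_sum_le_sum_abs _ _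
    _ ≤ 2 * ∑ j, A j * (2 * c * D ^ 2) * (w ^ 3 / R) + B * 3 * D * (w ^ 3 / R) := by
        gcongr with j _
        exact h1 j
    _ = _ := by rw [← Finset.sum_mul]; ring

theorem memLp_two_weight : MemLp (fun x : E5 => ((1 + ‖x‖) ^ 3)⁻¹) 2 volume := by
  have hc : Continuous fun x : E5 => ((1 + ‖x‖) ^ 3)⁻¹ :=
    Continuous.inv₀ (by fun_prop) fun x => by positivity
  refine (memLp_two_iff_integrable_sq hc.aestronglyMeasurable).2 ?_
  have h := integrable_one_add_norm (E := E5) (μ := volume) (r := 6)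
    (by rw [finrank_euclideanSpace]; norm_num)
  refine h.congr (ae_of_all _ fun x => ?_)
  have h0 : (0 : ℝ) ≤ 1 + ‖x‖ := by positivity
  simp only
  rw [Real.rpow_neg h0]
  norm_cast
  rw [inv_pow, ← pow_mul]

/-- For `ν` of either sign there is a comparison function `G = 1 / (1 + c |x|²)` such that
`ΔG - ν G` has a strict sign: for `ν ≥ 0` it is negative, and for `ν < 0` it is positive as soon
as `c` is small compared with `|ν|`. -/
theorem exists_bubble_sign (ν : ℝ) : ∃ c : ℝ, 0 < c ∧ ∃ σ : ℝ,
    ∀ x, 0 < σ * (lap (bubble c) x - ν * bubble c x) := by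
  rcases le_or_gt 0 ν with h | h
  · refine ⟨1, one_pos, -1, fun x => ?_⟩
    have hb := bubble_pos one_pos x
    rw [lap_bubble one_pos]
    have h1 : 0 < 1 * (10 + 2 * (1 * ‖x‖ ^ 2)) * bubble 1 x ^ 3 := by positivity
    have h2 : 0 ≤ ν * bubble 1 x := by positivity
    linarith
  · have hc : 0 < -ν / 20 := by linarith
    refine ⟨-ν / 20, hc, 1, fun x => ?_⟩
    have hb := bubble_pos hc x
    rw [lap_bubble hc]
    generalize hcc : -ν / 20 = c at *
    have hν : ν = -(20 * c) := by rw [← hcc]; ring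
    have hne : bubble c x * (1 + c * ‖x‖ ^ 2) = 1 := inv_mul_cancel₀ (by positivity)
    have h0 : 0 ≤ c * ‖x‖ ^ 2 := by positivity
    set t := c * ‖x‖ ^ 2
    have e : 1 * (-(c * (10 + 2 * t) * bubble c x ^ 3) - ν * bubble c x)
        = c * bubble c x ^ 3 * (20 * (1 + t) ^ 2 - (10 + 2 * t)) := by
      rw [hν]
      linear_combination (-20 * c * bubble c x * (bubble c x * (1 + t) + 1)) * hne
    rw [e]
    have : 0 < 20 * (1 + t) ^ 2 - (10 + 2 * t) := by nlinarith
    positivity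

/-- A nonnegative `f ∈ L²(ℝ⁵)` with `Δf = ν f` in the sense of distributions vanishes, whatever
the sign of `ν`. -/
theorem ae_eq_zero_of_lap_eq {f : E5 → ℝ} (hf : MemLp f 2 volume) (h0 : ∀ᵐ x, 0 ≤ f x) (ν : ℝ)
    (h : ∀ η, IsTest η → ∫ x, lap η x * f x = ν * ∫ x, η x * f x) :
    ∀ᵐ x, f x = 0 := by
  obtain ⟨c, hc, σ, hσ⟩ := exists_bubble_sign ν
  let θ : ContDiffBump (0 : E5) := ⟨1, 2, one_pos, one_lt_two⟩
  have hθ : IsTest θ := ⟨θ.contDiff, θ.hasCompactSupport⟩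
  have hθ0 : ∀ x : E5, 2 < ‖x‖ → θ x = 0 := fun x hx =>
    θ.zero_of_le_dist (by rw [dist_zero_right]; exact hx.le)
  obtain ⟨C, hC0, hC⟩ := exists_cutoffError_le hc hθ hθ0
  have hcut : ∀ R, 0 < R → IsTest (cutoffAt θ 0 R) := fun R hR =>
    ⟨contDiff_cutoffAt hθ.1 0 R, by
      have := hθ.2.comp_homeomorph (Homeomorph.smulOfNeZero R⁻¹ (inv_ne_zero hR.ne'))
      convert this using 1
      ext x
      simp [cutoffAt]⟩
  have hb := contDiff_bubble hc
  set g : E5 → ℝ := fun x => σ * (lap (bubble c) x - ν * bubble c x) with hg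
  have hlapc : Continuous (lap (bubble c)) := by
    unfold lap
    exact continuous_finsetSum _ fun j _ =>
      (contDiff_partialDeriv (contDiff_partialDeriv hb j) j).continuous
  have hgc : Continuous g := by
    have := hb.continuous
    fun_prop
  have hint : ∀ R, 0 < R → Integrable (fun x => cutoffAt θ 0 R x * g x * f x) := fun R hR =>
    ((((hcut R hR).continuous.mul hgc).memLp_of_hasCompactSupport (p := 2)
      (hcut R hR).2.mul_right).integrable_mul hf)
  have hwf : Integrable (fun x => ((1 + ‖x‖) ^ 3)⁻¹ * f x) := memLp_two_weight.integrable_mul hf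
  set I := ∫ x, ((1 + ‖x‖) ^ 3)⁻¹ * f x with hI
  -- The equation is tested with the truncated comparison function.
  have hbound : ∀ R, 1 ≤ R → ∫ x, cutoffAt θ 0 R x * g x * f x ≤ |σ| * C * I / R := by
    intro R hR
    have hR0 : 0 < R := by linarith
    have hη : IsTest (fun x => cutoffAt θ 0 R x * bubble c x) :=
      ⟨(hcut R hR0).1.mul hb, (hcut R hR0).2.mul_right⟩
    have e := h _ hη
    have i1 : Integrable (fun x => lap (fun x => cutoffAt θ 0 R x * bubble c x) x * f x) :=
      ((hη.lap).memLp 2).integrable_mul hf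
    have i2 : Integrable (fun x => cutoffAt θ 0 R x * bubble c x * f x) :=
      (hη.memLp 2).integrable_mul hf
    have e1 : ∀ x, σ * (lap (fun x => cutoffAt θ 0 R x * bubble c x) x * f x
        - ν * (cutoffAt θ 0 R x * bubble c x * f x)) - cutoffAt θ 0 R x * g x * f x
        = σ * (cutoffError c θ R x * f x) := by
      intro x
      rw [lap_mul (hcut R hR0).1 hb]
      simp only [hg, cutoffError]
      ring
    have e2 : ∫ x, σ * (lap (fun x => cutoffAt θ 0 R x * bubble c x) x * f x
        - ν * (cutoffAt θ 0 R x * bubble c x * f x)) = 0 := by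
      rw [integral_const_mul, integral_sub i1 (i2.const_mul ν), integral_const_mul, e, sub_self,
        mul_zero]
    have i3 : Integrable fun x => σ * (lap (fun x => cutoffAt θ 0 R x * bubble c x) x * f x
        - ν * (cutoffAt θ 0 R x * bubble c x * f x)) := (i1.sub (i2.const_mul ν)).const_mul σ
    have e3 : ∫ x, cutoffAt θ 0 R x * g x * f x = - ∫ x, σ * (cutoffError c θ R x * f x) := by
      simp only [← e1]
      rw [integral_sub i3 (hint R hR0), e2]
      ring
    rw [e3]
    refine (neg_le_abs _).trans ?_
    have e4 : ∫ x, |σ| * (C / R) * (((1 + ‖x‖) ^ 3)⁻¹ * f x) = |σ| * C * I / R := by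
      rw [integral_const_mul, ← hI]; ring
    rw [← e4, ← Real.norm_eq_abs]
    refine norm_integral_le_of_norm_le (hwf.const_mul _) (h0.mono fun x hx => ?_)
    rw [Real.norm_eq_abs, abs_mul, abs_mul, abs_of_nonneg hx, mul_assoc]
    have := hC R hR x
    calc |σ| * (|cutoffError c θ R x| * f x) ≤ |σ| * (C / R * ((1 + ‖x‖) ^ 3)⁻¹ * f x) := by
          gcongr
      _ = _ := by ring
  have hle : ∀ n R : ℝ, 0 < n → 2 * n ≤ R → ∀ x, cutoffAt θ 0 n x ≤ cutoffAt θ 0 R x := by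
    intro n R hn hR x
    have hR0 : 0 < R := by linarith
    by_cases hx : ‖x‖ ≤ 2 * n
    · have : cutoffAt θ 0 R x = 1 := θ.one_of_mem_closedBall (by
        simp only [sub_zero, Metric.mem_closedBall, dist_zero_right, norm_smul, norm_inv,
          Real.norm_eq_abs, abs_of_pos hR0]
        rw [inv_mul_eq_div, div_le_iff₀ hR0]
        change ‖x‖ ≤ 1 * R
        linarith)
      rw [this]
      exact θ.le_one
    · have : cutoffAt θ 0 n x = 0 := hθ0 _ (by
        rw [sub_zero, norm_smul, norm_inv, Real.norm_eq_abs, abs_of_pos hn, inv_mul_eq_div,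
          lt_div_iff₀ hn]
        linarith)
      rw [this]
      exact θ.nonneg
  have hnonneg : ∀ R : ℝ, ∀ᵐ x, 0 ≤ cutoffAt θ 0 R x * g x * f x := fun R =>
    h0.mono fun x hx => mul_nonneg (mul_nonneg θ.nonneg (hσ x).le) hx
  have hzero : ∀ n : ℝ, 0 < n → ∫ x, cutoffAt θ 0 n x * g x * f x = 0 := by
    intro n hn
    refine le_antisymm ?_ (integral_nonneg_of_ae (hnonneg n))
    have hlim : Filter.Tendsto (fun R : ℝ => |σ| * C * I / R) Filter.atTop (nhds 0) :=
      tendsto_const_nhds.div_atTop Filter.tendsto_id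
    refine ge_of_tendsto hlim ?_
    filter_upwards [Filter.eventually_ge_atTop (2 * n), Filter.eventually_ge_atTop 1] with R h1 h2
    refine le_trans ?_ (hbound R h2)
    refine integral_mono_ae (hint n hn) (hint R (by linarith)) (h0.mono fun x hx => ?_)
    exact mul_le_mul_of_nonneg_right
      (mul_le_mul_of_nonneg_right (hle n R hn h1 x) (hσ x).le) hx
  have hall : ∀ n : ℕ, ∀ᵐ x, cutoffAt θ 0 ((n : ℝ) + 1) x * g x * f x = 0 := fun n =>
    (integral_eq_zero_iff_of_nonneg_ae (hnonneg _) (hint _ (by positivity))).1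
      (hzero _ (by positivity))
  filter_upwards [ae_all_iff.2 hall] with x hx
  obtain ⟨n, hn⟩ := exists_nat_ge ‖x‖
  have hn1 : (0 : ℝ) < (n : ℝ) + 1 := by positivity
  have h1 : cutoffAt θ 0 ((n : ℝ) + 1) x = 1 := θ.one_of_mem_closedBall (by
    simp only [sub_zero, Metric.mem_closedBall, dist_zero_right, norm_smul, norm_inv,
      Real.norm_eq_abs, abs_of_pos hn1]
    rw [inv_mul_eq_div, div_le_iff₀ hn1]
    change ‖x‖ ≤ 1 * ((n : ℝ) + 1)
    linarith)
  have h2 := hx n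
  rw [h1, one_mul] at h2
  exact (mul_eq_zero.1 h2).resolve_left (hσ x).ne'

/-! ### The first variation at a ground state -/

theorem normSqL2_add {f g : E5 → ℂ} (hf : MemLp f 2 volume) (hg : MemLp g 2 volume) :
    normSqL2 (fun x => f x + g x)
      = normSqL2 f + 2 * (∫ x, ((starRingEnd ℂ) (f x) * g x).re) + normSqL2 g := by
  have hc : MemLp (fun x => (starRingEnd ℂ) (f x)) 2 volume := hf.star
  have i1 := integrable_normSq_of_memLp_two hf
  have i2 := integrable_normSq_of_memLp_two hg
  have i3 : Integrable fun x => ((starRingEnd ℂ) (f x) * g x).re :=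
    (integrable_mul_of_memLp_two hc hg).re
  have i4 : Integrable fun x => ‖f x‖ ^ 2 + 2 * ((starRingEnd ℂ) (f x) * g x).re :=
    i1.add (i3.const_mul 2)
  unfold normSqL2
  rw [← integral_const_mul, ← integral_add i1 (i3.const_mul 2), ← integral_add i4 i2]
  congr 1
  ext x
  simp only [← Complex.normSq_eq_norm_sq, Complex.normSq_apply, Complex.add_re, Complex.add_im,
    Complex.mul_re, Complex.conj_re, Complex.conj_im]
  ring

theorem re_integral_ofReal_mul {a : E5 → ℝ} {u : E5 → ℂ}
    (h : Integrable fun x => (a x : ℂ) * u x) :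
    (∫ x, (a x : ℂ) * u x).re = ∫ x, a x * (u x).re := by
  have := integral_re h
  simp only [RCLike.re_eq_complex_re] at this
  rw [← this]
  simp

theorem ae_eq_zero_of_normSqL2_eq_zero {f : E5 → ℂ} (hf : MemLp f 2 volume)
    (h : normSqL2 f = 0) : ∀ᵐ x, f x = 0 := by
  have := (integral_eq_zero_iff_of_nonneg (fun x => by positivity)
    (integrable_normSq_of_memLp_two hf)).1 h
  filter_upwards [this] with x hx
  simpa using hx

/-- Integration by parts onto the test function: `∫ Δη Re u = -∑ⱼ ∫ ∂ⱼη Re ∂ⱼu`. -/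
theorem integral_lap_mul_re {u : E5 → ℂ} (hu : MemH1 u) {η : E5 → ℝ} (hη : IsTest η) :
    ∫ x, lap η x * (u x).re = - ∑ j, ∫ x, partialDeriv j η x * (weakPartial j u x).re := by
  have key : ∀ j, ∫ x, partialDeriv j (partialDeriv j η) x * (u x).re
      = - ∫ x, partialDeriv j η x * (weakPartial j u x).re := by
    intro j
    have h := congrArg Complex.re
      (hu.hasWeakPartial_weakPartial j (partialDeriv j η) (hη.partialDeriv j))
    rwa [Complex.neg_re, re_integral_ofReal_mul
        (((hη.partialDeriv j).partialDeriv j).integrable_mul hu.1),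
      re_integral_ofReal_mul ((hη.partialDeriv j).integrable_mul (hu.memLp_weakPartial j))] at h
  have hi : ∀ j ∈ Finset.univ, Integrable fun x =>
      partialDeriv j (partialDeriv j η) x * (u x).re := fun j _ =>
    (((hη.partialDeriv j).partialDeriv j).memLp 2).integrable_mul hu.1.re
  simp only [lap, Finset.sum_mul]
  rw [integral_finsetSum _ hi, ← Finset.sum_neg_distrib]
  exact Finset.sum_congr rfl fun j _ => key j

/-- The triple `Q + (η, 0, 0)`. -/
noncomputable def perturb (Q : Triple) (η : E5 → ℝ) : Triple :=
  Function.update Q 0 fun x => Q 0 x + (η x : ℂ)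

theorem perturb_zero (Q : Triple) (η : E5 → ℝ) :
    perturb Q η 0 = fun x => Q 0 x + (η x : ℂ) := by simp [perturb]

theorem perturb_one (Q : Triple) (η : E5 → ℝ) : perturb Q η 1 = Q 1 := by simp [perturb]

theorem perturb_two (Q : Triple) (η : E5 → ℝ) : perturb Q η 2 = Q 2 := by simp [perturb]

section Perturb

variable {Q : Triple} {η : E5 → ℝ}

theorem memH1Triple_perturb (hQ : MemH1Triple Q) (hη : IsTest η) :
    MemH1Triple (perturb Q η) := by
  intro i
  by_cases h : i = 0
  · subst h
    rw [perturb_zero]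
    exact (hQ 0).add hη.memH1
  · simpa [perturb, h] using hQ i

theorem mass_perturb (hQ : MemH1Triple Q) (hη : IsTest η) :
    mass (perturb Q η) = mass Q + (∫ x, η x * (Q 0 x).re)
      + 1 / 2 * normSqL2 (fun x => (η x : ℂ)) := by
  unfold mass
  rw [perturb_zero, perturb_one, perturb_two, normSqL2_add (hQ 0).1 hη.ofReal_memLp]
  have : ∀ x, ((starRingEnd ℂ) (Q 0 x) * (η x : ℂ)).re = η x * (Q 0 x).re := fun x => by
    simp [mul_comm]
  simp only [this]
  ring

theorem kinetic_perturb (κ : Fin 3 → ℝ) (hQ : MemH1Triple Q) (hη : IsTest η) :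
    kinetic κ (perturb Q η) = kinetic κ Q
      + κ 0 * (∑ j, ∫ x, partialDeriv j η x * (weakPartial j (Q 0) x).re)
      + κ 0 / 2 * ∑ j, normSqL2 (fun x => (partialDeriv j η x : ℂ)) := by
  have key : normSqH1dot (fun x => Q 0 x + (η x : ℂ)) = normSqH1dot (Q 0)
      + 2 * (∑ j, ∫ x, partialDeriv j η x * (weakPartial j (Q 0) x).re)
      + ∑ j, normSqL2 (fun x => (partialDeriv j η x : ℂ)) := by
    unfold normSqH1dot
    rw [Finset.mul_sum, ← Finset.sum_add_distrib, ← Finset.sum_add_distrib]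
    refine Finset.sum_congr rfl fun j _ => ?_
    have e : weakPartial j (fun x => Q 0 x + (η x : ℂ)) =ᵐ[volume]
        fun x => weakPartial j (Q 0) x + (partialDeriv j η x : ℂ) :=
      ((hQ 0).weakPartial_add hη.memH1 j).trans
        ((hη.weakPartial_ae_eq j).mono fun x hx => by simp only [hx])
    rw [normSqL2_congr e, normSqL2_add ((hQ 0).memLp_weakPartial j)
      (hη.partialDeriv j).ofReal_memLp]
    have : ∀ x, ((starRingEnd ℂ) (weakPartial j (Q 0) x) * (partialDeriv j η x : ℂ)).re
        = partialDeriv j η x * (weakPartial j (Q 0) x).re := fun x => by simp [mul_comm]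
    simp only [this]
  simp only [kinetic, Fin.sum_univ_three, perturb_zero, perturb_one, perturb_two, key]
  ring

/-- The integrand of the potential energy is integrable as soon as `V ≠ 0`: the Bochner integral
of a non-integrable function is `0`. -/
theorem integrable_of_potential_ne_zero (h : potential Q ≠ 0) :
    Integrable fun x => (starRingEnd ℂ) (Q 0 x) * (starRingEnd ℂ) (Q 1 x) * Q 2 x := by
  by_contra hn
  exact h (by rw [potential, integral_undef hn, Complex.zero_re])

theorem potential_perturb (hQ : MemH1Triple Q) (hV : potential Q ≠ 0) (hη : IsTest η) :
    potential (perturb Q η)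
      = potential Q + ∫ x, η x * ((starRingEnd ℂ) (Q 1 x) * Q 2 x).re := by
  obtain ⟨C, -, hC⟩ := exists_bound_of_test hη
  have h12 : Integrable fun x => (η x : ℂ) * ((starRingEnd ℂ) (Q 1 x) * Q 2 x) := by
    have h := integrable_mul_of_memLp_two
      (memLp_ofReal_mul hη.continuous hC (hQ 1).1.star) (hQ 2).1
    refine h.congr (ae_of_all _ fun x => ?_)
    simp only [mul_assoc]
    rfl
  unfold potential
  rw [perturb_zero, perturb_one, perturb_two, ← re_integral_ofReal_mul h12, ← Complex.add_re,
    ← integral_add (integrable_of_potential_ne_zero hV) h12]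
  congr 2
  ext x
  simp only [map_add, Complex.conj_ofReal]
  ring

end Perturb

theorem weinstein_nonneg {κ : Fin 3 → ℝ} (hκ : ∀ i, 0 < κ i) (u : Triple) : 0 ≤ weinstein κ u := by
  have := mass_nonneg u
  have := kinetic_nonneg hκ u
  unfold weinstein
  positivity

theorem weinstein_sq {κ : Fin 3 → ℝ} (hκ : ∀ i, 0 < κ i) (u : Triple) :
    weinstein κ u ^ 2 = mass u * kinetic κ u ^ 5 / potential u ^ 4 := by
  have hM := mass_nonneg u
  have hK := kinetic_nonneg hκ u
  have e1 : (mass u ^ (1 / 2 : ℝ)) ^ 2 = mass u := by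
    rw [← Real.rpow_natCast, ← Real.rpow_mul hM]; norm_num
  have e2 : (kinetic κ u ^ (5 / 2 : ℝ)) ^ 2 = kinetic κ u ^ 5 := by
    rw [← Real.rpow_natCast, ← Real.rpow_mul hK]
    norm_num
  unfold weinstein
  rw [div_pow, mul_pow, e1, e2]
  ring

/-- The derivative at `s = 0` of `M(s) K(s)⁵ / V(s)⁴` vanishes if `0` is a minimum. -/
theorem first_variation_eq_zero {M K V A B P a b : ℝ} (hK : K ≠ 0) (hV : V ≠ 0)
    (h : ∀ s : ℝ, V + s * P ≠ 0 → M * K ^ 5 / V ^ 4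
      ≤ (M + s * A + s ^ 2 * a) * (K + s * B + s ^ 2 * b) ^ 5 / (V + s * P) ^ 4) :
    K * V * A + 5 * M * V * B - 4 * M * K * P = 0 := by
  have dM : HasDerivAt (fun s : ℝ => M + s * A + s ^ 2 * a) A 0 := by
    exact ((((hasDerivAt_id (0 : ℝ)).mul_const A).const_add M).add
      (((hasDerivAt_id (0 : ℝ)).pow 2).mul_const a)).congr_deriv (by simp)
  have dK : HasDerivAt (fun s : ℝ => K + s * B + s ^ 2 * b) B 0 := by
    exact ((((hasDerivAt_id (0 : ℝ)).mul_const B).const_add K).add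
      (((hasDerivAt_id (0 : ℝ)).pow 2).mul_const b)).congr_deriv (by simp)
  have dV : HasDerivAt (fun s : ℝ => V + s * P) P 0 := by
    simpa using ((hasDerivAt_id (0 : ℝ)).mul_const P).const_add V
  have hd := (dM.mul (dK.pow 5)).div (dV.pow 4) (by simpa using pow_ne_zero 4 hV)
  have hmin : IsLocalMin (((fun s : ℝ => M + s * A + s ^ 2 * a)
      * (fun s : ℝ => K + s * B + s ^ 2 * b) ^ 5) / (fun s : ℝ => V + s * P) ^ 4) 0 := by
    have hne : ∀ᶠ s : ℝ in nhds 0, V + s * P ≠ 0 :=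
      dV.continuousAt.eventually_ne (by simpa using hV)
    filter_upwards [hne] with s hs
    simpa using h s hs
  have h0 := hmin.hasDerivAt_eq_zero hd
  simp at h0
  rcases h0 with h0 | h0
  · have : K ^ 4 * V ^ 3 * (K * V * A + 5 * M * V * B - 4 * M * K * P) = 0 := by
      linear_combination h0
    have hne : K ^ 4 * V ^ 3 ≠ 0 := by positivity
    exact (mul_eq_zero.1 this).resolve_left hne
  · exact absurd h0 hV

/-! ### The Pohozaev identity and the sharp inequality -/

section GroundState

variable {κ : Fin 3 → ℝ} {Q : Triple}

theorem IsGroundState.re_nonneg (hQ : IsGroundState κ Q) (i : Fin 3) :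
    ∀ᵐ x, 0 ≤ (Q i x).re := by
  obtain ⟨g, hg, h⟩ := hQ.nonneg_radial i
  filter_upwards [h] with x hx
  rw [hx, Complex.ofReal_re]
  exact hg _

theorem IsGroundState.conj_ae_eq (hQ : IsGroundState κ Q) (i : Fin 3) :
    ∀ᵐ x, (starRingEnd ℂ) (Q i x) = Q i x := by
  obtain ⟨g, -, h⟩ := hQ.nonneg_radial i
  filter_upwards [h] with x hx
  rw [hx, Complex.conj_ofReal]

theorem IsGroundState.not_ae_zero (hQ : IsGroundState κ Q) : ¬ ∀ᵐ x, Q 0 x = 0 := by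
  intro h
  refine hQ.memXi.2 ?_
  have : ∫ x, (starRingEnd ℂ) (Q 0 x) * (starRingEnd ℂ) (Q 1 x) * Q 2 x = 0 :=
    integral_eq_zero_of_ae (h.mono fun x hx => by simp [hx])
  rw [potential, this, Complex.zero_re]

/-- The first component of a ground state is not an eigenfunction of the Laplacian. -/
theorem IsGroundState.not_lap_eq (hQ : IsGroundState κ Q) (ν : ℝ) :
    ¬ ∀ η, IsTest η → ∫ x, lap η x * (Q 0 x).re = ν * ∫ x, η x * (Q 0 x).re := by
  intro h
  refine hQ.not_ae_zero ?_
  have h0 := ae_eq_zero_of_lap_eq (hQ.memXi.1 0).1.re (hQ.re_nonneg 0) ν h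
  filter_upwards [h0, hQ.conj_ae_eq 0] with x hx hc
  exact Complex.ext hx (Complex.conj_eq_iff_im.1 hc)

theorem IsGroundState.mass_pos (hQ : IsGroundState κ Q) : 0 < mass Q := by
  refine (mass_nonneg Q).lt_of_ne' fun h => hQ.not_ae_zero ?_
  have h0 := normSqL2_nonneg (Q 0)
  have h1 := normSqL2_nonneg (Q 1)
  have h2 := normSqL2_nonneg (Q 2)
  unfold mass at h
  exact ae_eq_zero_of_normSqL2_eq_zero (hQ.memXi.1 0).1 (by linarith)

theorem IsGroundState.kinetic_pos (hκ : ∀ i, 0 < κ i) (hQ : IsGroundState κ Q) :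
    0 < kinetic κ Q := by
  refine (kinetic_nonneg hκ Q).lt_of_ne' fun h => hQ.not_lap_eq 0 fun η hη => ?_
  have hz : normSqH1dot (Q 0) = 0 := by
    have h1 := (Finset.sum_eq_zero_iff_of_nonneg fun i _ =>
      mul_nonneg (by linarith [hκ i]) (normSqH1dot_nonneg (Q i))).1 h 0 (Finset.mem_univ _)
    exact (mul_eq_zero.1 h1).resolve_left (by linarith [hκ 0])
  have hz' : ∀ j, normSqL2 (weakPartial j (Q 0)) = 0 := fun j =>
    (Finset.sum_eq_zero_iff_of_nonneg fun j _ => normSqL2_nonneg _).1 hz j (Finset.mem_univ _)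
  rw [integral_lap_mul_re (hQ.memXi.1 0) hη, zero_mul, neg_eq_zero]
  refine Finset.sum_eq_zero fun j _ => integral_eq_zero_of_ae ?_
  filter_upwards [ae_eq_zero_of_normSqL2_eq_zero ((hQ.memXi.1 0).memLp_weakPartial j) (hz' j)]
    with x hx
  simp [hx]

/-- The equation for `φ₁`, tested with `η`. -/
theorem IsGroundState.re_eq_one (hQ : IsGroundState κ Q) {η : E5 → ℝ} (hη : IsTest η) :
    (∫ x, η x * (Q 0 x).re)
        + κ 0 * ∑ j, ∫ x, partialDeriv j η x * (weakPartial j (Q 0) x).re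
      = ∫ x, η x * ((starRingEnd ℂ) (Q 1 x) * Q 2 x).re := by
  obtain ⟨C, -, hC⟩ := exists_bound_of_test hη
  have h12 : Integrable fun x => (η x : ℂ) * (Q 1 x * Q 2 x) := by
    have h := integrable_mul_of_memLp_two
      (memLp_ofReal_mul hη.continuous hC (hQ.memXi.1 1).1) (hQ.memXi.1 2).1
    simpa only [mul_assoc] using h
  have h := congrArg Complex.re (hQ.eq_one η hη)
  simp only [Complex.ofReal_one, one_mul, Complex.add_re, Complex.re_ofReal_mul,
    Complex.re_sum] at h
  rw [re_integral_ofReal_mul (hη.integrable_mul (hQ.memXi.1 0).1), re_integral_ofReal_mul h12] at h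
  have hj : ∀ j, (∫ x, (partialDeriv j η x : ℂ) * weakPartial j (Q 0) x).re
      = ∫ x, partialDeriv j η x * (weakPartial j (Q 0) x).re := fun j =>
    re_integral_ofReal_mul ((hη.partialDeriv j).integrable_mul ((hQ.memXi.1 0).memLp_weakPartial j))
  simp only [hj] at h
  rw [h]
  refine integral_congr_ae ?_
  filter_upwards [hQ.conj_ae_eq 1] with x hx
  rw [hx]

theorem IsTest.const_mul {η : E5 → ℝ} (hη : IsTest η) (s : ℝ) : IsTest (fun x => s * η x) :=
  hη.mul_left contDiff_const

theorem normSqL2_ofReal_const_mul (s : ℝ) (a : E5 → ℝ) :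
    normSqL2 (fun x => ((s * a x : ℝ) : ℂ)) = s ^ 2 * normSqL2 (fun x => (a x : ℂ)) := by
  unfold normSqL2
  rw [← integral_const_mul]
  congr 1
  ext x
  simp [mul_pow]

/-- The Euler–Lagrange equation of the Weinstein functional in the first component. -/
theorem IsGroundState.euler_lagrange (hκ : ∀ i, 0 < κ i) (hQ : IsGroundState κ Q) {η : E5 → ℝ}
    (hη : IsTest η) :
    kinetic κ Q * potential Q * (∫ x, η x * (Q 0 x).re)
      + 5 * mass Q * potential Q
        * (κ 0 * ∑ j, ∫ x, partialDeriv j η x * (weakPartial j (Q 0) x).re)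
      - 4 * mass Q * kinetic κ Q * (∫ x, η x * ((starRingEnd ℂ) (Q 1 x) * Q 2 x).re) = 0 := by
  refine first_variation_eq_zero (a := 1 / 2 * normSqL2 (fun x => (η x : ℂ)))
    (b := κ 0 / 2 * ∑ j, normSqL2 (fun x => (partialDeriv j η x : ℂ)))
    (hQ.kinetic_pos hκ).ne' hQ.memXi.2 fun s hs => ?_
  have hsη := hη.const_mul s
  have eM : mass (perturb Q fun x => s * η x) = mass Q + s * (∫ x, η x * (Q 0 x).re)
      + s ^ 2 * (1 / 2 * normSqL2 (fun x => (η x : ℂ))) := by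
    rw [mass_perturb hQ.memXi.1 hsη, normSqL2_ofReal_const_mul]
    simp only [mul_assoc s, integral_const_mul]
    ring
  have eK : kinetic κ (perturb Q fun x => s * η x) = kinetic κ Q
      + s * (κ 0 * ∑ j, ∫ x, partialDeriv j η x * (weakPartial j (Q 0) x).re)
      + s ^ 2 * (κ 0 / 2 * ∑ j, normSqL2 (fun x => (partialDeriv j η x : ℂ))) := by
    rw [kinetic_perturb κ hQ.memXi.1 hsη]
    simp only [partialDeriv_const_mul hη.1, normSqL2_ofReal_const_mul, mul_assoc s,
      integral_const_mul, ← Finset.mul_sum]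
    ring
  have eV : potential (perturb Q fun x => s * η x) = potential Q
      + s * (∫ x, η x * ((starRingEnd ℂ) (Q 1 x) * Q 2 x).re) := by
    rw [potential_perturb hQ.memXi.1 hQ.memXi.2 hsη]
    simp only [mul_assoc s, integral_const_mul]
  rw [← eM, ← eK, ← eV, ← weinstein_sq hκ, ← weinstein_sq hκ]
  have := hQ.minimal _ ⟨memH1Triple_perturb hQ.memXi.1 hsη, by rwa [eV]⟩
  exact pow_le_pow_left₀ (weinstein_nonneg hκ Q) this 2

/-- Pohozaev identity `5 V(Q) = 4 K(Q)`. If it failed, the Euler–Lagrange equation of the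
Weinstein functional and the equation for `φ₁` would be independent, and eliminating the
nonlinearity would leave a linear equation `Δφ₁ = ν φ₁`. -/
theorem IsGroundState.pohozaev (hκ : ∀ i, 0 < κ i) (hQ : IsGroundState κ Q) :
    5 * potential Q = 4 * kinetic κ Q := by
  by_contra hne
  have hM := hQ.mass_pos
  have hK := hQ.kinetic_pos hκ
  have hκ0 := hκ 0
  have hd : 5 * potential Q - 4 * kinetic κ Q ≠ 0 := sub_ne_zero.2 hne
  refine hQ.not_lap_eq (kinetic κ Q * (potential Q - 4 * mass Q)
    / (κ 0 * (mass Q * (5 * potential Q - 4 * kinetic κ Q)))) fun η hη => ?_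
  have h1 := hQ.euler_lagrange hκ hη
  have h2 := hQ.re_eq_one hη
  rw [← h2] at h1
  rw [integral_lap_mul_re (hQ.memXi.1 0) hη, div_mul_eq_mul_div,
    eq_div_iff (mul_ne_zero hκ0.ne' (mul_ne_zero hM.ne' hd))]
  linear_combination -h1

/-- The sharp Gagliardo–Nirenberg inequality, with the constant evaluated by the Pohozaev
identity. -/
theorem IsGroundState.potential_le (hκ : ∀ i, 0 < κ i) (hQ : IsGroundState κ Q) {u : Triple}
    (hu : MemH1Triple u) {θ : ℝ} (hθ : 0 ≤ θ)
    (h : mass u * kinetic κ u ≤ θ ^ 4 * (mass Q * kinetic κ Q)) :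
    5 * potential u ≤ 4 * θ * kinetic κ u := by
  have hM := hQ.mass_pos
  have hK := hQ.kinetic_pos hκ
  have hMu := mass_nonneg u
  have hKu := kinetic_nonneg hκ u
  have hP := hQ.pohozaev hκ
  by_cases hV : potential u = 0
  · rw [hV, mul_zero]; positivity
  have h1 := pow_le_pow_left₀ (weinstein_nonneg hκ Q) (hQ.minimal u ⟨hu, hV⟩) 2
  rw [weinstein_sq hκ, weinstein_sq hκ, div_le_div_iff₀ (Even.pow_pos (by decide) hQ.memXi.2)
    (Even.pow_pos (by decide) hV)] at h1
  have hVQ : potential Q = 4 / 5 * kinetic κ Q := by linarith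
  rw [hVQ] at h1
  refine le_of_pow_le_pow_left₀ (n := 4) (by norm_num) (by positivity) ?_
  have h2 : mass Q * kinetic κ Q ^ 5 * potential u ^ 4
      ≤ kinetic κ Q ^ 5 * mass Q * ((4 / 5 * θ * kinetic κ u) ^ 4) := by
    refine h1.trans ?_
    calc mass u * kinetic κ u ^ 5 * (4 / 5 * kinetic κ Q) ^ 4
        = (4 / 5) ^ 4 * kinetic κ u ^ 4 * kinetic κ Q ^ 4 * (mass u * kinetic κ u) := by ring
      _ ≤ (4 / 5) ^ 4 * kinetic κ u ^ 4 * kinetic κ Q ^ 4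
          * (θ ^ 4 * (mass Q * kinetic κ Q)) := by gcongr
      _ = _ := by ring
  have hpos : 0 < kinetic κ Q ^ 5 * mass Q := by positivity
  have h3 : potential u ^ 4 ≤ (4 / 5 * θ * kinetic κ u) ^ 4 :=
    le_of_mul_le_mul_left (by linarith) hpos
  calc (5 * potential u) ^ 4 = 5 ^ 4 * potential u ^ 4 := by ring
    _ ≤ 5 ^ 4 * (4 / 5 * θ * kinetic κ u) ^ 4 := by gcongr
    _ = _ := by ring

end GroundState

/-! ### Galilean boosts -/

theorem contDiff_phase (ξ : E5) (k : ℝ) : ContDiff ℝ ∞ (fun x : E5 => ⟪x, ξ⟫ / k) :=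
  (contDiff_id.inner ℝ contDiff_const).div_const k

theorem partialDeriv_comp_phase {F : ℝ → ℝ} {F' : ℝ} (ξ : E5) (k : ℝ) (j : Fin 5) (x : E5)
    (hF : HasDerivAt F F' (⟪x, ξ⟫ / k)) :
    partialDeriv j (fun x => F (⟪x, ξ⟫ / k)) x = F' * (ξ j / k) := by
  have h1 : HasFDerivAt (fun y : E5 => ⟪y, ξ⟫ / k) (k⁻¹ • innerSL ℝ ξ) x := by
    have h := (innerSL ℝ ξ).hasFDerivAt.const_mul k⁻¹ (x := x)
    refine h.congr_of_eventuallyEq (Filter.Eventually.of_forall fun y => ?_)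
    simp [real_inner_comm, div_eq_inv_mul]
  have h3 : fderiv ℝ (fun x : E5 => F (⟪x, ξ⟫ / k)) x = _ := (hF.comp_hasFDerivAt x h1).fderiv
  unfold partialDeriv
  rw [h3]
  simp [EuclideanSpace.inner_single_right]
  exact Or.inl (by ring)

theorem isMultiplier_cos_phase (ξ : E5) (k : ℝ) :
    IsMultiplier (fun x : E5 => Real.cos (⟪x, ξ⟫ / k)) where
  smooth := Real.contDiff_cos.comp (contDiff_phase ξ k)
  bounded := ⟨1, fun _ => Real.abs_cos_le_one _⟩
  bounded_partial j := ⟨|ξ j / k|, fun x => by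
    rw [partialDeriv_comp_phase ξ k j x (Real.hasDerivAt_cos _), abs_mul, abs_neg]
    exact mul_le_of_le_one_left (abs_nonneg _) (Real.abs_sin_le_one _)⟩

theorem isMultiplier_sin_phase (ξ : E5) (k : ℝ) :
    IsMultiplier (fun x : E5 => Real.sin (⟪x, ξ⟫ / k)) where
  smooth := Real.contDiff_sin.comp (contDiff_phase ξ k)
  bounded := ⟨1, fun _ => Real.abs_sin_le_one _⟩
  bounded_partial j := ⟨|ξ j / k|, fun x => by
    rw [partialDeriv_comp_phase ξ k j x (Real.hasDerivAt_sin _), abs_mul]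
    exact mul_le_of_le_one_left (abs_nonneg _) (Real.abs_cos_le_one _)⟩

theorem exp_I_mul_ofReal (t : ℝ) : Complex.exp (Complex.I * (t : ℂ))
    = (Real.cos t : ℂ) + Complex.I * (Real.sin t : ℂ) := by
  rw [mul_comm, Complex.exp_mul_I, Complex.ofReal_cos, Complex.ofReal_sin]
  ring

theorem norm_exp_I_mul_phase (t : ℝ) : ‖Complex.exp (Complex.I * (t : ℂ))‖ = 1 := by
  rw [mul_comm, Complex.norm_exp_ofReal_mul_I]

theorem phase_mul_eq (ξ : E5) (k : ℝ) (u : E5 → ℂ) :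
    (fun x => Complex.exp (Complex.I * ((⟪x, ξ⟫ / k : ℝ) : ℂ)) * u x)
      = fun x => ((Real.cos (⟪x, ξ⟫ / k) : ℝ) : ℂ) * u x
        + Complex.I * (((Real.sin (⟪x, ξ⟫ / k) : ℝ) : ℂ) * u x) := by
  ext x
  rw [exp_I_mul_ofReal]
  ring

theorem MemH1.phase_mul {u : E5 → ℂ} (h : MemH1 u) (ξ : E5) (k : ℝ) :
    MemH1 (fun x => Complex.exp (Complex.I * ((⟪x, ξ⟫ / k : ℝ) : ℂ)) * u x) := by
  rw [phase_mul_eq]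
  exact (h.ofReal_mul (isMultiplier_cos_phase ξ k)).add
    ((h.ofReal_mul (isMultiplier_sin_phase ξ k)).const_mul Complex.I)

theorem MemH1.weakPartial_phase_mul {u : E5 → ℂ} (h : MemH1 u) (ξ : E5) (k : ℝ) (j : Fin 5) :
    weakPartial j (fun x => Complex.exp (Complex.I * ((⟪x, ξ⟫ / k : ℝ) : ℂ)) * u x) =ᵐ[volume]
      fun x => Complex.exp (Complex.I * ((⟪x, ξ⟫ / k : ℝ) : ℂ))
        * (weakPartial j u x + Complex.I * ((ξ j / k : ℝ) : ℂ) * u x) := by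
  have hc := h.ofReal_mul (isMultiplier_cos_phase ξ k)
  have hs := h.ofReal_mul (isMultiplier_sin_phase ξ k)
  rw [phase_mul_eq]
  filter_upwards [hc.weakPartial_add (hs.const_mul Complex.I) j,
    hs.weakPartial_const_mul Complex.I j,
    h.weakPartial_ofReal_mul (isMultiplier_cos_phase ξ k) j,
    h.weakPartial_ofReal_mul (isMultiplier_sin_phase ξ k) j] with x h1 h2 h3 h4
  rw [h1, h2, h3, h4, partialDeriv_comp_phase ξ k j x (Real.hasDerivAt_cos _),
    partialDeriv_comp_phase ξ k j x (Real.hasDerivAt_sin _), exp_I_mul_ofReal]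
  push_cast
  linear_combination (-(Complex.sin (⟪x, ξ⟫ / k : ℂ)) * (ξ j / k) * u x) * Complex.I_sq

theorem normSqL2_phase_mul (ξ : E5) (k : ℝ) (u : E5 → ℂ) :
    normSqL2 (fun x => Complex.exp (Complex.I * ((⟪x, ξ⟫ / k : ℝ) : ℂ)) * u x) = normSqL2 u := by
  unfold normSqL2
  simp only [norm_mul, norm_exp_I_mul_phase, one_mul]

theorem MemH1.normSqH1dot_phase_mul {u : E5 → ℂ} (h : MemH1 u) (ξ : E5) (k : ℝ) :
    normSqH1dot (fun x => Complex.exp (Complex.I * ((⟪x, ξ⟫ / k : ℝ) : ℂ)) * u x)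
      = normSqH1dot u
        + 2 / k * (∑ j, ξ j * ∫ x, ((starRingEnd ℂ) (u x) * weakPartial j u x).im)
        + ‖ξ‖ ^ 2 / k ^ 2 * normSqL2 u := by
  have key : ∀ j, normSqL2 (weakPartial j
      fun x => Complex.exp (Complex.I * ((⟪x, ξ⟫ / k : ℝ) : ℂ)) * u x)
      = normSqL2 (weakPartial j u)
        + 2 / k * (ξ j * ∫ x, ((starRingEnd ℂ) (u x) * weakPartial j u x).im)
        + ξ j ^ 2 * (normSqL2 u / k ^ 2) := by
    intro j
    rw [normSqL2_congr (h.weakPartial_phase_mul ξ k j), normSqL2_phase_mul,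
      normSqL2_add (h.memLp_weakPartial j) (h.1.const_mul _)]
    have e1 : ∀ x, ((starRingEnd ℂ) (weakPartial j u x)
        * (Complex.I * ((ξ j / k : ℝ) : ℂ) * u x)).re
        = ξ j / k * ((starRingEnd ℂ) (u x) * weakPartial j u x).im := by
      intro x
      simp only [Complex.mul_re, Complex.mul_im, Complex.conj_re, Complex.conj_im, Complex.I_re,
        Complex.I_im, Complex.ofReal_re, Complex.ofReal_im]
      ring
    have e2 : normSqL2 (fun x => Complex.I * ((ξ j / k : ℝ) : ℂ) * u x)
        = (ξ j / k) ^ 2 * normSqL2 u := by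
      unfold normSqL2
      rw [← integral_const_mul]
      congr 1
      ext x
      simp only [norm_mul, Complex.norm_I, Complex.norm_real, Real.norm_eq_abs, one_mul, mul_pow,
        sq_abs]
    simp only [e1, e2, integral_const_mul]
    ring
  unfold normSqH1dot
  simp only [key, Finset.sum_add_distrib]
  rw [← Finset.mul_sum, ← Finset.sum_mul, EuclideanSpace.norm_sq_eq]
  simp only [Real.norm_eq_abs, sq_abs]
  ring

section Boost

variable {κ : Fin 3 → ℝ} {u : Triple}

theorem memH1Triple_boost (κ : Fin 3 → ℝ) (ξ : E5) (hu : MemH1Triple u) :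
    MemH1Triple (boost κ ξ u) := fun i => (hu i).phase_mul ξ (κ i)

theorem mass_boost (κ : Fin 3 → ℝ) (ξ : E5) (u : Triple) : mass (boost κ ξ u) = mass u := by
  unfold mass boost
  simp only [normSqL2_phase_mul]

/-- Mass resonance makes the three phases cancel in the potential energy. -/
theorem potential_boost (hres : 1 / κ 2 = 1 / κ 0 + 1 / κ 1) (ξ : E5) (u : Triple) :
    potential (boost κ ξ u) = potential u := by
  unfold potential boost
  congr 2
  ext x
  have e : ∀ t : ℝ, (starRingEnd ℂ) (Complex.exp (Complex.I * (t : ℂ)))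
      = Complex.exp (-(Complex.I * (t : ℂ))) := by
    intro t
    rw [← Complex.exp_conj]
    simp
  have h0 : -(Complex.I * ((⟪x, ξ⟫ / κ 0 : ℝ) : ℂ)) + -(Complex.I * ((⟪x, ξ⟫ / κ 1 : ℝ) : ℂ))
      + Complex.I * ((⟪x, ξ⟫ / κ 2 : ℝ) : ℂ) = 0 := by
    have : ⟪x, ξ⟫ / κ 2 = ⟪x, ξ⟫ / κ 0 + ⟪x, ξ⟫ / κ 1 := by
      linear_combination ⟪x, ξ⟫ * hres
    rw [this]
    push_cast
    ring
  have h1 := congrArg Complex.exp h0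
  rw [Complex.exp_add, Complex.exp_add, Complex.exp_zero] at h1
  simp only [map_mul, e]
  linear_combination ((starRingEnd ℂ) (u 0 x) * (starRingEnd ℂ) (u 1 x) * u 2 x) * h1

theorem kinetic_boost (hκ : ∀ i, 0 < κ i) (ξ : E5) (hu : MemH1Triple u) :
    kinetic κ (boost κ ξ u) = kinetic κ u
      + (∑ j, ξ j * ∑ i, ∫ x, ((starRingEnd ℂ) (u i x) * weakPartial j (u i) x).im)
      + ‖ξ‖ ^ 2 / 2 * ∑ i, (κ i)⁻¹ * normSqL2 (u i) := by
  have key : ∀ i, κ i / 2 * normSqH1dot (boost κ ξ u i) = κ i / 2 * normSqH1dot (u i)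
      + (∑ j, ξ j * ∫ x, ((starRingEnd ℂ) (u i x) * weakPartial j (u i) x).im)
      + ‖ξ‖ ^ 2 / 2 * ((κ i)⁻¹ * normSqL2 (u i)) := by
    intro i
    have := (hκ i).ne'
    unfold boost
    rw [(hu i).normSqH1dot_phase_mul ξ (κ i)]
    field_simp
  unfold kinetic
  simp only [key, Finset.sum_add_distrib, ← Finset.mul_sum]
  congr 2
  rw [Finset.sum_comm]
  simp only [Finset.mul_sum]

/-- Coercivity of boosted functions: either the boost raises the kinetic energy, and the sharp
inequality for `u` suffices, or it lowers it, and the sharp inequality applies to the boost. -/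
theorem IsGroundState.potential_le_boost {Q : Triple} (hκ : ∀ i, 0 < κ i)
    (hres : 1 / κ 2 = 1 / κ 0 + 1 / κ 1) (hQ : IsGroundState κ Q)
    (hu : MemH1Triple u) {θ : ℝ} (hθ : 0 ≤ θ)
    (h : mass u * kinetic κ u ≤ θ ^ 4 * (mass Q * kinetic κ Q)) (ξ : E5) :
    5 * potential u ≤ 4 * θ * kinetic κ (boost κ ξ u) := by
  rcases le_total (kinetic κ u) (kinetic κ (boost κ ξ u)) with hle | hle
  · exact (hQ.potential_le hκ hu hθ h).trans (by gcongr)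
  · rw [← potential_boost hres ξ u]
    refine hQ.potential_le hκ (memH1Triple_boost κ ξ hu) hθ ?_
    rw [mass_boost]
    have := mass_nonneg u
    exact (mul_le_mul_of_nonneg_left hle this).trans h

end Boost

/-! ### Localization -/

section Cutoff

variable {ε : ℝ} {χ : E5 → ℝ}

theorem IsCutoff.isTest (h : IsCutoff ε χ) : IsTest χ :=
  ⟨h.smooth, HasCompactSupport.intro (isCompact_closedBall 0 1) fun x hx =>
    h.eq_zero x (by simpa using hx)⟩

theorem IsCutoff.abs_le_one (h : IsCutoff ε χ) (x : E5) : |χ x| ≤ 1 := by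
  have h1 : χ x ≤ 1 := by
    have := h.radial_antitone 0 x (by simp)
    rwa [h.eq_one 0 (by simpa using h.eps_lt_one.le)] at this
  have h0 : 0 ≤ χ x := by
    by_cases hx : 1 < ‖x‖
    · rw [h.eq_zero x hx]
    · obtain ⟨y, hy⟩ := NormedSpace.exists_lt_norm ℝ E5 1
      have := h.radial_antitone x y (by linarith)
      rwa [h.eq_zero y hy] at this
  rwa [abs_of_nonneg h0]

theorem IsCutoff.exists_partialDeriv_le (h : IsCutoff ε χ) :
    ∃ A, 0 ≤ A ∧ ∀ (s : E5) (R : ℝ), 0 < R → ∀ j x,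
      |partialDeriv j (cutoffAt χ s R) x| ≤ A / R := by
  choose A hA0 hA using fun j => exists_bound_of_test (h.isTest.partialDeriv j)
  refine ⟨∑ j, A j, Finset.sum_nonneg fun j _ => hA0 j, fun s R hR j x => ?_⟩
  rw [partialDeriv_cutoffAt h.smooth, abs_mul, abs_inv, abs_of_pos hR, div_eq_inv_mul]
  have h1 : |cutoffAt (partialDeriv j χ) s R x| ≤ A j := hA j _
  have h2 : A j ≤ ∑ j, A j := Finset.single_le_sum (fun j _ => hA0 j) (Finset.mem_univ j)
  gcongr
  exact h1.trans h2

theorem IsCutoff.isMultiplier (h : IsCutoff ε χ) (s : E5) {R : ℝ} (hR : 0 < R) :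
    IsMultiplier (cutoffAt χ s R) where
  smooth := contDiff_cutoffAt h.smooth s R
  bounded := ⟨1, fun _ => h.abs_le_one _⟩
  bounded_partial j := by
    obtain ⟨A, -, hA⟩ := h.exists_partialDeriv_le
    exact ⟨A / R, hA s R hR j⟩

end Cutoff

section Localize

variable {κ : Fin 3 → ℝ} {u : Triple} {ρ : E5 → ℝ}

theorem memH1Triple_localize (hρ : IsMultiplier ρ) (hu : MemH1Triple u) :
    MemH1Triple (localize ρ u) := fun i => (hu i).ofReal_mul hρ

theorem localize_boost (κ : Fin 3 → ℝ) (ρ : E5 → ℝ) (ξ : E5) (u : Triple) :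
    localize ρ (boost κ ξ u) = boost κ ξ (localize ρ u) := by
  funext i x
  simp only [localize, boost]
  ring

theorem normSqL2_ofReal_mul (ρ : E5 → ℝ) (f : E5 → ℂ) :
    normSqL2 (fun x => (ρ x : ℂ) * f x) = ∫ x, ‖f x‖ ^ 2 * ρ x ^ 2 := by
  unfold normSqL2
  congr 1
  ext x
  rw [norm_mul, mul_pow, Complex.norm_real, Real.norm_eq_abs, sq_abs, mul_comm]

/-- Since `ρ` is real, the gradient falling on `ρ` does not contribute to the momentum. -/
theorem localMomentum_apply (hρ : IsMultiplier ρ) (hu : MemH1Triple u) (j : Fin 5) :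
    localMomentum ρ u j = ∑ i, ∫ x,
      ((starRingEnd ℂ) (localize ρ u i x) * weakPartial j (localize ρ u i) x).im := by
  have hl := memH1Triple_localize hρ hu
  have hi : ∀ i ∈ Finset.univ, Integrable fun x =>
      ((starRingEnd ℂ) (localize ρ u i x) * weakPartial j (localize ρ u i) x).im := fun i _ =>
    (integrable_mul_of_memLp_two (hl i).1.star ((hl i).memLp_weakPartial j)).im
  rw [← integral_finsetSum _ hi]
  change ∫ x, _ = _
  refine integral_congr_ae ?_
  have hw : ∀ᵐ x, ∀ i, weakPartial j (localize ρ u i) x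
      = (ρ x : ℂ) * weakPartial j (u i) x + (partialDeriv j ρ x : ℂ) * u i x :=
    ae_all_iff.2 fun i => (hu i).weakPartial_ofReal_mul hρ j
  filter_upwards [hw] with x hx
  rw [Complex.im_sum, Finset.sum_mul]
  refine Finset.sum_congr rfl fun i _ => ?_
  rw [hx i]
  simp only [localize, map_mul, Complex.conj_ofReal, Complex.mul_im, Complex.mul_re,
    Complex.add_re, Complex.add_im, Complex.ofReal_re, Complex.ofReal_im, Complex.conj_re,
    Complex.conj_im]
  ring

theorem localWeight_eq (hκ : ∀ i, 0 < κ i) (hρ : IsMultiplier ρ) (hu : MemH1Triple u) :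
    localWeight κ ρ u = κ 0 * κ 1 * κ 2 * ∑ i, (κ i)⁻¹ * normSqL2 (localize ρ u i) := by
  have hi : ∀ i, Integrable fun x => ‖u i x‖ ^ 2 * ρ x ^ 2 := fun i => by
    refine (integrable_normSq_of_memLp_two (hρ.memLp_mul (hu i).1)).congr (ae_of_all _ fun x => ?_)
    simp only [norm_mul, mul_pow, Complex.norm_real, Real.norm_eq_abs, sq_abs]
    ring
  have e : ∀ i, normSqL2 (localize ρ u i) = ∫ x, ‖u i x‖ ^ 2 * ρ x ^ 2 := fun i =>
    normSqL2_ofReal_mul ρ (u i)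
  have h0 := (hκ 0).ne'
  have h1 := (hκ 1).ne'
  have h2 := (hκ 2).ne'
  have e2 : ∀ x, (κ 1 * κ 2 * ‖u 0 x‖ ^ 2 + κ 0 * κ 2 * ‖u 1 x‖ ^ 2
      + κ 0 * κ 1 * ‖u 2 x‖ ^ 2) * ρ x ^ 2
      = ∑ i, κ 0 * κ 1 * κ 2 * (κ i)⁻¹ * (‖u i x‖ ^ 2 * ρ x ^ 2) := by
    intro x
    rw [Fin.sum_univ_three]
    field_simp
  simp only [localWeight, e2, e]
  rw [integral_finsetSum _ fun i _ => (hi i).const_mul _, Finset.mul_sum]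
  simp only [integral_const_mul, mul_assoc]

/-- The frequency `ξ` minimizes the kinetic energy of the boosted localized triple among all
boosts; in particular it does not exceed the one without boost. -/
theorem kinetic_boost_xi_le (hκ : ∀ i, 0 < κ i) (hρ : IsMultiplier ρ) (hu : MemH1Triple u) :
    kinetic κ (localize ρ (boost κ (xi κ ρ u) u)) ≤ kinetic κ (localize ρ u) := by
  rw [localize_boost, kinetic_boost hκ _ (memH1Triple_localize hρ hu)]
  simp only [← localMomentum_apply hρ hu]
  have hW := localWeight_eq hκ hρ hu
  set S := ∑ i, (κ i)⁻¹ * normSqL2 (localize ρ u i) with hS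
  have hS0 : 0 ≤ S := Finset.sum_nonneg fun i _ =>
    mul_nonneg (inv_nonneg.2 (hκ i).le) (normSqL2_nonneg _)
  have hk : 0 < κ 0 * κ 1 * κ 2 := mul_pos (mul_pos (hκ 0) (hκ 1)) (hκ 2)
  set p := localMomentum ρ u
  by_cases hz : localWeight κ ρ u = 0
  · have hx : xi κ ρ u = 0 := by rw [xi, if_pos hz]
    rw [hx]
    simp
  · have hS1 : 0 < S := hS0.lt_of_ne' fun h => hz (by rw [hW, h, mul_zero])
    have hx : xi κ ρ u = -(S⁻¹ • p) := by
      rw [xi, if_neg hz, hW]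
      congr 2
      rw [div_mul_eq_div_div, div_self hk.ne', one_div]
    have hp : ∑ j, p j ^ 2 = ‖p‖ ^ 2 := by simp [EuclideanSpace.norm_sq_eq]
    have e1 : ∑ j, xi κ ρ u j * p j = -(S⁻¹ * ‖p‖ ^ 2) := by
      rw [hx, ← hp, Finset.mul_sum, ← Finset.sum_neg_distrib]
      refine Finset.sum_congr rfl fun j _ => ?_
      simp only [PiLp.neg_apply, PiLp.smul_apply, smul_eq_mul]
      ring
    have e2 : ‖xi κ ρ u‖ ^ 2 / 2 * S = S⁻¹ * ‖p‖ ^ 2 / 2 := by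
      rw [hx, norm_neg, norm_smul, norm_inv, Real.norm_eq_abs, abs_of_pos hS1]
      field_simp
    rw [e1, e2]
    have : 0 ≤ S⁻¹ * ‖p‖ ^ 2 := by positivity
    linarith

theorem normSqL2_localize_le (hρ : IsMultiplier ρ) (h1 : ∀ x, |ρ x| ≤ 1) {f : E5 → ℂ}
    (hf : MemLp f 2 volume) : normSqL2 (fun x => (ρ x : ℂ) * f x) ≤ normSqL2 f := by
  refine integral_mono (integrable_normSq_of_memLp_two (hρ.memLp_mul hf))
    (integrable_normSq_of_memLp_two hf) fun x => ?_
  simp only [norm_mul, Complex.norm_real, Real.norm_eq_abs]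
  have := mul_le_of_le_one_left (norm_nonneg (f x)) (h1 x)
  gcongr

theorem mass_localize_le (hρ : IsMultiplier ρ) (h1 : ∀ x, |ρ x| ≤ 1) (hu : MemH1Triple u) :
    mass (localize ρ u) ≤ mass u := by
  have h : ∀ i, normSqL2 (localize ρ u i) ≤ normSqL2 (u i) := fun i =>
    normSqL2_localize_le hρ h1 (hu i).1
  have := h 0
  have := h 1
  have := h 2
  unfold mass
  linarith

/-- Young's inequality for the gradient of a product `ρ u` with `|ρ| ≤ 1` and `|∂ⱼρ| ≤ A`. -/
theorem normSqH1dot_localize_le (hρ : IsMultiplier ρ) (h1 : ∀ x, |ρ x| ≤ 1) {A : ℝ}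
    (hA : ∀ j x, |partialDeriv j ρ x| ≤ A) {f : E5 → ℂ} (hf : MemH1 f) {θ : ℝ} (hθ : 0 < θ) :
    normSqH1dot (fun x => (ρ x : ℂ) * f x)
      ≤ (1 + θ) * normSqH1dot f + 5 * ((1 + θ⁻¹) * A ^ 2 * normSqL2 f) := by
  have key : ∀ j, normSqL2 (weakPartial j fun x => (ρ x : ℂ) * f x)
      ≤ (1 + θ) * normSqL2 (weakPartial j f) + (1 + θ⁻¹) * A ^ 2 * normSqL2 f := by
    intro j
    have i1 := integrable_normSq_of_memLp_two (hf.memLp_weakPartial j)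
    have i2 := integrable_normSq_of_memLp_two hf.1
    rw [normSqL2_congr (hf.weakPartial_ofReal_mul hρ j)]
    unfold normSqL2
    rw [← integral_const_mul, ← integral_const_mul,
      ← integral_add (i1.const_mul _) (i2.const_mul _)]
    refine integral_mono (integrable_normSq_of_memLp_two
      (hρ.memLp_leibniz hf.1 (hf.memLp_weakPartial j) j))
      ((i1.const_mul _).add (i2.const_mul _)) fun x => ?_
    have e1 : ‖(ρ x : ℂ) * weakPartial j f x + (partialDeriv j ρ x : ℂ) * f x‖
        ≤ ‖weakPartial j f x‖ + A * ‖f x‖ := by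
      refine (norm_add_le _ _).trans ?_
      simp only [norm_mul, Complex.norm_real, Real.norm_eq_abs]
      exact add_le_add (mul_le_of_le_one_left (norm_nonneg _) (h1 x))
        (mul_le_mul_of_nonneg_right (hA j x) (norm_nonneg _))
    set p := ‖weakPartial j f x‖
    set q := ‖f x‖
    have hθ1 : θ⁻¹ * θ = 1 := inv_mul_cancel₀ hθ.ne'
    calc _ ≤ (p + A * q) ^ 2 := by gcongr
      _ ≤ (p + A * q) ^ 2 + θ⁻¹ * (θ * p - A * q) ^ 2 :=
          le_add_of_nonneg_right (mul_nonneg (inv_nonneg.2 hθ.le) (sq_nonneg _))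
      _ = (1 + θ) * p ^ 2 + (1 + θ⁻¹) * A ^ 2 * q ^ 2 := by
          linear_combination (θ * p ^ 2 - 2 * p * A * q) * hθ1
  unfold normSqH1dot
  refine (Finset.sum_le_sum fun j _ => key j).trans (le_of_eq ?_)
  rw [Finset.sum_add_distrib, ← Finset.mul_sum, Finset.sum_const, Finset.card_univ,
    Fintype.card_fin, nsmul_eq_mul]
  norm_num

theorem kinetic_localize_le (hκ : ∀ i, 0 < κ i) (hρ : IsMultiplier ρ) (h1 : ∀ x, |ρ x| ≤ 1)
    {A : ℝ} (hA : ∀ j x, |partialDeriv j ρ x| ≤ A) (hu : MemH1Triple u)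
    {θ : ℝ} (hθ : 0 < θ) :
    kinetic κ (localize ρ u)
      ≤ (1 + θ) * kinetic κ u + 5 * (1 + θ⁻¹) * (∑ i, κ i) * A ^ 2 * mass u := by
  have hm : ∀ i, normSqL2 (u i) / 2 ≤ mass u := by
    have h0 := normSqL2_nonneg (u 0)
    have h1 := normSqL2_nonneg (u 1)
    have h2 := normSqL2_nonneg (u 2)
    intro i
    unfold mass
    fin_cases i <;> simp <;> linarith
  have key : ∀ i, κ i / 2 * normSqH1dot (localize ρ u i)
      ≤ (1 + θ) * (κ i / 2 * normSqH1dot (u i)) + κ i * (5 * (1 + θ⁻¹) * A ^ 2 * mass u) := by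
    intro i
    have hk := hκ i
    calc κ i / 2 * normSqH1dot (localize ρ u i)
        ≤ κ i / 2 * ((1 + θ) * normSqH1dot (u i)
          + 5 * ((1 + θ⁻¹) * A ^ 2 * normSqL2 (u i))) := by
          gcongr
          exact normSqH1dot_localize_le hρ h1 hA (hu i) hθ
      _ = (1 + θ) * (κ i / 2 * normSqH1dot (u i))
          + κ i * (5 * (1 + θ⁻¹) * A ^ 2 * (normSqL2 (u i) / 2)) := by ring
      _ ≤ _ := by
          gcongr
          exact hm i
  unfold kinetic
  refine (Finset.sum_le_sum fun i _ => key i).trans (le_of_eq ?_)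
  rw [Finset.sum_add_distrib, ← Finset.mul_sum, ← Finset.sum_mul]
  ring

end Localize

/-- Truncation raises `M K` by little: if `M(u) K(u) ≤ (1 - δ₀) D` with `δ₀ > δ`, then for large
`R`, uniformly in the centre, the localized boosted triple stays below `(1 - δ) D` with a fixed
margin. -/
theorem exists_radius_mass_mul_kinetic_le {κ : Fin 3 → ℝ} (hκ : ∀ i, 0 < κ i) {ε : ℝ}
    {χ : E5 → ℝ} (hχ : IsCutoff ε χ) {δ δ₀ D : ℝ} (hδ₀ : 0 < δ) (hδ₁ : δ < 1) (hδ : δ < δ₀)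
    (hD : 0 < D) (m : ℝ) :
    ∃ θ, 0 < θ ∧ ∃ R₀ : ℝ, 0 < R₀ ∧ ∀ R, R₀ ≤ R → ∀ (s : E5) (u : Triple), MemH1Triple u →
      mass u ≤ m → mass u * kinetic κ u ≤ (1 - δ₀) * D →
      mass (localBoost κ χ s R u) * kinetic κ (localBoost κ χ s R u) ≤ (1 - δ - θ) * D := by
  obtain ⟨A, hA0, hA⟩ := hχ.exists_partialDeriv_le
  -- For `δ₀ > 1` the hypothesis cannot hold, and `min δ₀ 1` may replace `δ₀`. A third of the gap
  -- pays for Young's inequality, a third for the term `R⁻² M(u)²`, and a third is the margin.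
  set θ := (min δ₀ 1 - δ) / 3 with hθdef
  have hmin : δ < min δ₀ 1 := lt_min hδ hδ₁
  have hθ : 0 < θ := by linarith
  have hk : 0 < ∑ i, κ i := Finset.sum_pos (fun i _ => hκ i) Finset.univ_nonempty
  set B := 5 * (1 + θ⁻¹) * (∑ i, κ i) * A ^ 2 with hB
  have hB0 : 0 ≤ B := by positivity
  refine ⟨θ, hθ, 1 + B * m ^ 2 / (θ * D), by positivity, fun R hR s u hu hm hMK => ?_⟩
  have hR1 : 1 ≤ R := le_trans (le_add_of_nonneg_right (by positivity)) hR
  have hR0 : 0 < R := by linarith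
  have hρ := hχ.isMultiplier s hR0
  have hM := mass_nonneg u
  have hK := kinetic_nonneg hκ u
  have h1 : mass (localBoost κ χ s R u) ≤ mass u := by
    rw [localBoost, localize_boost, mass_boost]
    exact mass_localize_le hρ (fun x => hχ.abs_le_one _) hu
  have h2 : kinetic κ (localBoost κ χ s R u)
      ≤ (1 + θ) * kinetic κ u + B / R ^ 2 * mass u := by
    refine (kinetic_boost_xi_le hκ hρ hu).trans ((kinetic_localize_le hκ hρ
      (fun x => hχ.abs_le_one _) (hA s R hR0) hu hθ).trans (le_of_eq ?_))
    rw [hB, div_pow]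
    ring
  have h3 : B / R ^ 2 * m ^ 2 ≤ θ * D := by
    have e1 : B * m ^ 2 / (θ * D) ≤ R ^ 2 := by nlinarith
    rw [div_le_iff₀ (by positivity)] at e1
    rw [div_mul_eq_mul_div, div_le_iff₀ (by positivity)]
    linarith
  have h4 : (1 + θ) * (mass u * kinetic κ u) ≤ (1 - min δ₀ 1 + θ) * D := by
    have e1 : (1 - δ₀) * D ≤ (1 - min δ₀ 1) * D := by
      have := min_le_left δ₀ 1
      gcongr
    have e2 : 0 ≤ θ * min δ₀ 1 * D := by
      have := hδ₀.trans hmin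
      positivity
    calc (1 + θ) * (mass u * kinetic κ u) ≤ (1 + θ) * ((1 - min δ₀ 1) * D) := by
          have := hMK.trans e1
          gcongr
      _ ≤ _ := by linarith
  calc _ ≤ mass u * ((1 + θ) * kinetic κ u + B / R ^ 2 * mass u) :=
        mul_le_mul h1 h2 (kinetic_nonneg hκ _) hM
    _ = (1 + θ) * (mass u * kinetic κ u) + B / R ^ 2 * mass u ^ 2 := by ring
    _ ≤ (1 - min δ₀ 1 + θ) * D + B / R ^ 2 * m ^ 2 := by gcongr
    _ ≤ (1 - min δ₀ 1 + θ) * D + θ * D := by linarith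
    _ = (1 - δ - θ) * D := by rw [hθdef]; ring

end NLSSystem

open NLSSystem in
theorem lemma3p6 (δ : ℝ) (hδ₀ : 0 < δ) (hδ₁ : δ < 1) :
    ∃ δ' : ℝ, 0 < δ' ∧
      ∀ κ : Fin 3 → ℝ, (∀ i, 0 < κ i) → 1 / κ 2 = 1 / κ 0 + 1 / κ 1 →
      ∀ Q : Triple, IsGroundState κ Q →
        -- coercivity of boosted functions
        (∀ u : Triple, MemH1Triple u →
          mass u * kinetic κ u ≤ (1 - δ) * (mass Q * kinetic κ Q) →
          ∀ ξ : E5, MemH1Triple (boost κ ξ u) ∧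
            δ' * kinetic κ (boost κ ξ u)
              ≤ 4 * kinetic κ (boost κ ξ u) - 5 * potential u) ∧
        -- coercivity on balls
        (∀ (ε : ℝ) (χ : E5 → ℝ), IsCutoff ε χ →
          ∀ (δ₀ : ℝ), δ < δ₀ → ∀ m : ℝ,
          ∃ R₀ : ℝ, 0 < R₀ ∧ ∀ R : ℝ, R₀ ≤ R → ∀ (s : E5) (u : ℝ → Triple),
            (∀ t, MemH1Triple (u t)) → (∀ t, mass (u t) ≤ m) →
            (∀ t, mass (u t) * kinetic κ (u t) ≤ (1 - δ₀) * (mass Q * kinetic κ Q)) →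
            (∀ t, MemH1Triple (localBoost κ χ s R (u t))) ∧
            BddAbove (Set.range fun t =>
              mass (localBoost κ χ s R (u t)) * kinetic κ (localBoost κ χ s R (u t))) ∧
            (⨆ t, mass (localBoost κ χ s R (u t)) * kinetic κ (localBoost κ χ s R (u t)))
              < (1 - δ) * (mass Q * kinetic κ Q) ∧
            ∀ t, δ' * kinetic κ (localBoost κ χ s R (u t))
              ≤ 4 * kinetic κ (localBoost κ χ s R (u t))
                - 5 * potential (localize (cutoffAt χ s R) (u t))) := by
  set θ : ℝ := (1 - δ) ^ (1 / 4 : ℝ) with hθ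
  have h1δ : 0 ≤ 1 - δ := by linarith
  have hθ0 : 0 ≤ θ := Real.rpow_nonneg h1δ _
  have hθ1 : θ < 1 := Real.rpow_lt_one h1δ (by linarith) (by norm_num)
  have hθ4 : θ ^ 4 = 1 - δ := by
    rw [hθ, ← Real.rpow_natCast, ← Real.rpow_mul h1δ]
    norm_num
  refine ⟨4 * (1 - θ), by linarith, fun κ hκ hres Q hQ => ⟨fun u hu h ξ => ?_,
    fun ε χ hχ δ₀ hδ m => ?_⟩⟩
  · rw [← hθ4] at h
    have := hQ.potential_le_boost hκ hres hu hθ0 h ξ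
    exact ⟨memH1Triple_boost κ ξ hu, by linarith⟩
  · have hD : 0 < mass Q * kinetic κ Q := mul_pos hQ.mass_pos (hQ.kinetic_pos hκ)
    obtain ⟨τ, hτ, R₀, hR₀, hR⟩ := exists_radius_mass_mul_kinetic_le hκ hχ hδ₀ hδ₁ hδ hD m
    refine ⟨R₀, hR₀, fun R hRR s u hu hm hMK => ?_⟩
    have hH1 : ∀ t, MemH1Triple (localBoost κ χ s R (u t)) := fun t =>
      memH1Triple_localize (hχ.isMultiplier s (hR₀.trans_le hRR)) (memH1Triple_boost κ _ (hu t))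
    have hle := fun t => hR R hRR s (u t) (hu t) (hm t) (hMK t)
    have hlt : (1 - δ - τ) * (mass Q * kinetic κ Q) < (1 - δ) * (mass Q * kinetic κ Q) :=
      mul_lt_mul_of_pos_right (by linarith) hD
    refine ⟨hH1, ⟨_, Set.forall_mem_range.2 hle⟩, (ciSup_le hle).trans_lt hlt, fun t => ?_⟩
    have hV : potential (localBoost κ χ s R (u t))
        = potential (localize (cutoffAt χ s R) (u t)) := by
      rw [localBoost, localize_boost, potential_boost hres]
    have := hQ.potential_le hκ (hH1 t) hθ0 (by rw [hθ4]; exact (hle t).trans hlt.le)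
    rw [hV] at this
    linarith
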